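/- Let $K$ be a field, $Q$ a finite quiver and $I$ an admissible ideal of the path algebra $KQ$, where for paths $p,q$ the product $pq$ means "$q$ followed by $p$". Let $\Lambda = KQ/I$; all modules are left modules. For a finite dimensional algebra $A$, $\operatorname{fin\,dim} A$ denotes the supremum of the projective dimensions of the finitely generated $A$-modules of finite projective dimension, and syzygies $\Omega^n_A$ are formed by means of projective covers. Let $E = E' \sqcup E''$ be a partition of the vertex set of $Q$ into two nonempty sets such that (a) every arrow that starts in $E'$ also ends in $E'$, and (b) whenever $\alpha$ is an arrow from a vertex of $E''$ to a vertex of $E'$ and $\beta$ is an arrow with $\alpha\beta \notin I$, the arrow $\beta$ starts in a source of $Q$. Let $e'$ and $e''$ be the sums of the primitive idempotents of $\Lambda$ corresponding to the vertices in $E'$ and in $E''$, respectively, and put $\Lambda' = e'\Lambda e'$, $\Lambda'' = e''\Lambda e''$. Since $e''\Lambda e' = 0$, the map $\lambda \mapsto e''\lambda e''$ is a surjective ring homomorphism $\Lambda \to \Lambda''$, through which every $\Lambda''$-module is also a $\Lambda$-module. Let $Q''$ be the full subquiver of $Q$ with vertex set $E''$, so that $\Lambda'' \cong KQ''/(I \cap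 KQ'')$. Suppose that $\Lambda''$ is monomial, that is, the ideal $I \cap KQ''$ of $KQ''$ can be generated by paths. Suppose also that every path $p$ of $Q''$ which does not lie in $I$, has positive length, starts in a non-source of $Q''$ and satisfies $\operatorname{p\,dim}_{\Lambda''} \Lambda'' p < \infty$ ends in a homogeneous vertex, i.e. in a vertex $e \in E''$ such that all arrows of $Q$ starting in $e$ end in $E''$. Let $N$ be any $\Lambda$-module of finite projective dimension. Then the second syzygy $\Omega^2_{\Lambda''}(e''N)$ has the same projective dimension over $\Lambda''$ as over $\Lambda$. In particular, if $N$ is moreover finitely generated and $\operatorname{p\,dim}_\Lambda N > \operatorname{fin\,dim} \Lambda' + 2$, then $\operatorname{p\,dim}_{\Lambda''} e''N = \operatorname{p\,dim}_\Lambda N$. -/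

import Mathlib

universe u

open CategoryTheory

noncomputable section

namespace Stacks

/-! ### Path algebras of quivers -/

section PathAlgebra

variable (K V : Type u) [Field K] [Quiver.{u} V]

/-- All paths of a quiver, including the paths of length zero: a start vertex, an end vertex and a
path between them. -/
abbrev TotalPath : Type u := Σ a b : V, Quiver.Path a b

/-- The path algebra `K V`: the `K`-vector space with basis the paths of the quiver `V`. -/
def PathAlgebra : Type u := TotalPath V →₀ K

namespace PathAlgebra

instance : AddCommGroup (PathAlgebra K V) := inferInstanceAs (AddCommGroup (TotalPath V →₀ K))

instance : Module K (PathAlgebra K V) := inferInstanceAs (Module K (TotalPath V →₀ K))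

variable {V}

/-- The basis element of the path algebra given by a path. -/
def of (p : TotalPath V) : PathAlgebra K V := Finsupp.single p (1 : K)

variable {K}

/-- The coefficient of an element of the path algebra at a path. -/
def coeff (x : PathAlgebra K V) (p : TotalPath V) : K := (show TotalPath V →₀ K from x) p

variable (K)

open Classical in
/-- The product of two paths: `p q` is `q` followed by `p` if `q` ends where `p` starts, and zero
otherwise. -/
def mulPath (p q : TotalPath V) : PathAlgebra K V :=
  if h : p.1 = q.2.1 then of K ⟨q.1, p.2.1, q.2.2.comp (p.2.2.cast h rfl)⟩ else 0

variable (V)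

/-- The multiplication of the path algebra: the bilinear extension of the product of paths. -/
def mulLin : PathAlgebra K V →ₗ[K] PathAlgebra K V →ₗ[K] PathAlgebra K V :=
  Finsupp.linearCombination K fun p : TotalPath V =>
    (Finsupp.linearCombination K fun q : TotalPath V => mulPath K p q :
      (TotalPath V →₀ K) →ₗ[K] PathAlgebra K V)

instance : Mul (PathAlgebra K V) := ⟨fun x y => mulLin K V x y⟩

variable {K V}

theorem mul_def (x y : PathAlgebra K V) : x * y = mulLin K V x y := rfl

theorem of_mul_of (p q : TotalPath V) : of K p * of K q = mulPath K p q := by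
  rw [mul_def, mulLin, of, of]
  erw [Finsupp.linearCombination_single, one_smul, Finsupp.linearCombination_single, one_smul]

theorem of_mul_of_comp {a b c : V} (p : Quiver.Path b c) (q : Quiver.Path a b) :
    of K ⟨b, c, p⟩ * of K ⟨a, b, q⟩ = of K ⟨a, c, q.comp p⟩ := by
  rw [of_mul_of, mulPath, dif_pos rfl]
  rfl

theorem of_mul_of_ne {p q : TotalPath V} (h : p.1 ≠ q.2.1) : of K p * of K q = 0 := by
  rw [of_mul_of, mulPath, dif_neg h]

/-- Two linear maps on the path algebra that agree on paths are equal. -/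
theorem hom_ext {M : Type*} [AddCommGroup M] [Module K M] {f g : PathAlgebra K V →ₗ[K] M}
    (h : ∀ p, f (of K p) = g (of K p)) : f = g :=
  Finsupp.lhom_ext' (φ := f) (ψ := g) fun p => LinearMap.ext_ring (h p)

theorem of_assoc (p q r : TotalPath V) :
    of K p * of K q * of K r = of K p * (of K q * of K r) := by
  obtain ⟨a, b, p⟩ := p
  obtain ⟨c, d, q⟩ := q
  obtain ⟨e, f, r⟩ := r
  by_cases h1 : a = d
  · subst h1
    by_cases h2 : c = f
    · subst h2
      simp only [of_mul_of_comp, Quiver.Path.comp_assoc]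
    · rw [of_mul_of_comp, of_mul_of_ne h2, of_mul_of_ne (by exact h2), mul_def, map_zero]
  · rw [of_mul_of_ne (by exact h1), mul_def, map_zero, LinearMap.zero_apply]
    by_cases h2 : c = f
    · subst h2
      rw [of_mul_of_comp, of_mul_of_ne (by exact h1)]
    · rw [of_mul_of_ne (p := ⟨c, d, q⟩) (by exact h2), mul_def, map_zero]

/-- The primitive idempotent given by a vertex: the path of length zero at that vertex. -/
def vertex (K : Type u) [Field K] (v : V) : PathAlgebra K V := of K ⟨v, v, Quiver.Path.nil⟩

theorem mul_assoc' (x y z : PathAlgebra K V) : x * y * z = x * (y * z) := by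
  have h1 (p q : TotalPath V) (z : PathAlgebra K V) :
      of K p * of K q * z = of K p * (of K q * z) :=
    LinearMap.congr_fun (f := mulLin K V (of K p * of K q))
      (g := (mulLin K V (of K p)).comp (mulLin K V (of K q)))
      (hom_ext fun r => of_assoc p q r) z
  have h2 (p : TotalPath V) (y : PathAlgebra K V) : of K p * y * z = of K p * (y * z) :=
    LinearMap.congr_fun (f := ((mulLin K V).flip z).comp (mulLin K V (of K p)))
      (g := (mulLin K V (of K p)).comp ((mulLin K V).flip z))
      (hom_ext fun q => h1 p q z) y
  exact LinearMap.congr_fun (f := ((mulLin K V).flip z).comp ((mulLin K V).flip y))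
    (g := (mulLin K V).flip (y * z)) (hom_ext fun p => h2 p y) x

instance : NonUnitalRing (PathAlgebra K V) where
  __ := (inferInstance : AddCommGroup (PathAlgebra K V))
  left_distrib x y z := map_add (mulLin K V x) y z
  right_distrib x y z := by simp only [mul_def, map_add, LinearMap.add_apply]
  zero_mul x := by simp only [mul_def, map_zero, LinearMap.zero_apply]
  mul_zero x := map_zero (mulLin K V x)
  mul_assoc := mul_assoc'

theorem smul_mul' (c : K) (x y : PathAlgebra K V) : (c • x) * y = c • (x * y) := by
  simp only [mul_def, map_smul, LinearMap.smul_apply]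

theorem mul_smul' (c : K) (x y : PathAlgebra K V) : x * (c • y) = c • (x * y) := by
  simp only [mul_def, map_smul]

/-- The sum of the primitive idempotents that belong to a set of vertices. -/
def vertexSum (K : Type u) [Field K] (E : Finset V) : PathAlgebra K V := ∑ v ∈ E, vertex K v

open Classical in
theorem vertexSum_mul_of (E : Finset V) (p : TotalPath V) :
    vertexSum K E * of K p = if p.2.1 ∈ E then of K p else 0 := by
  obtain ⟨a, b, p⟩ := p
  have h (v : V) : vertex K v * of K ⟨a, b, p⟩ = if v = b then of K ⟨a, b, p⟩ else 0 := by
    split_ifs with hv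
    · subst hv
      exact of_mul_of_comp _ _
    · exact of_mul_of_ne hv
  simp only [vertexSum, Finset.sum_mul, h, Finset.sum_ite_eq']

open Classical in
theorem of_mul_vertexSum (E : Finset V) (p : TotalPath V) :
    of K p * vertexSum K E = if p.1 ∈ E then of K p else 0 := by
  obtain ⟨a, b, p⟩ := p
  have h (v : V) : of K ⟨a, b, p⟩ * vertex K v = if a = v then of K ⟨a, b, p⟩ else 0 := by
    split_ifs with hv
    · subst hv
      exact (of_mul_of_comp _ _).trans (by rw [Quiver.Path.nil_comp])
    · exact of_mul_of_ne hv
  simp only [vertexSum, Finset.mul_sum, h, Finset.sum_ite_eq]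

variable [Fintype V]

instance : Ring (PathAlgebra K V) where
  __ := (inferInstance : NonUnitalRing (PathAlgebra K V))
  one := vertexSum K Finset.univ
  one_mul x := LinearMap.congr_fun (f := mulLin K V (vertexSum K Finset.univ))
    (g := LinearMap.id) (hom_ext fun p => by
      change vertexSum K Finset.univ * of K p = of K p
      simp [vertexSum_mul_of]) x
  mul_one x := LinearMap.congr_fun (f := (mulLin K V).flip (vertexSum K Finset.univ))
    (g := LinearMap.id) (hom_ext fun p => by
      change of K p * vertexSum K Finset.univ = of K p
      simp [of_mul_vertexSum]) x

instance : Algebra K (PathAlgebra K V) := Algebra.ofModule smul_mul' mul_smul'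

theorem one_def : (1 : PathAlgebra K V) = vertexSum K Finset.univ := rfl

theorem vertexSum_mul_self (E : Finset V) : vertexSum K E * vertexSum K E = vertexSum K E := by
  conv_lhs => rw [vertexSum, Finset.sum_mul, ← vertexSum]
  refine Finset.sum_congr rfl fun v hv => ?_
  exact (of_mul_vertexSum E ⟨v, v, Quiver.Path.nil⟩).trans (if_pos hv)

end PathAlgebra

end PathAlgebra

open PathAlgebra

/-! ### Path algebras modulo relations -/

section Relations

variable {K V : Type u} [Field K] [Quiver.{u} V]

/-- A vertex is a source if no arrow ends in it. -/
def IsSource (v : V) : Prop := ∀ w : V, IsEmpty (w ⟶ v)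

/-- The full subquiver on a set of vertices. -/
def FullSubquiver (E : Finset V) : Type u := {v : V // v ∈ E}

instance (E : Finset V) : Quiver.{u} (FullSubquiver E) := ⟨fun a b => a.1 ⟶ b.1⟩

instance (E : Finset V) : Fintype (FullSubquiver E) := inferInstanceAs (Fintype {v : V // v ∈ E})

/-- The inclusion of a full subquiver. -/
def FullSubquiver.incl (E : Finset V) : FullSubquiver E ⥤q V where
  obj a := a.1
  map f := f

/-- A path of a full subquiver, viewed as a path of the whole quiver. -/
def inclPath (E : Finset V) (p : TotalPath (FullSubquiver E)) : TotalPath V :=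
  ⟨p.1.1, p.2.1.1, (FullSubquiver.incl E).mapPath p.2.2⟩

/-- The embedding of the path algebra of a full subquiver into the path algebra of the quiver. -/
def inclLin (K : Type u) [Field K] (E : Finset V) :
    PathAlgebra K (FullSubquiver E) →ₗ[K] PathAlgebra K V :=
  Finsupp.lmapDomain K K (inclPath E)

variable [Fintype V]

/-- A two-sided ideal `I` of a path algebra is admissible if `Rᵐ ⊆ I ⊆ R²` for some `m`, where `R`
is the ideal generated by the arrows. (`Rᵐ` is spanned by the paths of length at least `m`.) -/
structure IsAdmissible (I : Ideal (PathAlgebra K V)) : Prop where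
  exists_length_le : ∃ m : ℕ, ∀ p : TotalPath V, m ≤ p.2.2.length → of K p ∈ I
  two_le_length : ∀ x ∈ I, ∀ p : TotalPath V, coeff x p ≠ 0 → 2 ≤ p.2.2.length

/-- For a full subquiver with vertex set `E`, the algebra `K E / (I ∩ K E)` is monomial: the ideal
`I ∩ K E` of the path algebra `K E` can be generated, as a two-sided ideal, by paths. -/
def IsMonomialOn (I : Ideal (PathAlgebra K V)) (E : Finset V) : Prop :=
  ∃ S : Set (TotalPath (FullSubquiver E)),
    inclLin K E ⁻¹' (I : Set (PathAlgebra K V)) =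
      (TwoSidedIdeal.span (of K '' S) : Set (PathAlgebra K (FullSubquiver E)))

/-- A stacking partition `E' ∪ E''` of the vertices, for the algebra `K V / I`. -/
structure IsStackingPartition (I : Ideal (PathAlgebra K V)) (E' E'' : Finset V) : Prop where
  disjoint : Disjoint E' E''
  cover : ∀ v : V, v ∈ E' ∨ v ∈ E''
  /-- Every arrow that starts in `E'` ends in `E'`. -/
  arrow : ∀ ⦃a b : V⦄, (a ⟶ b) → a ∈ E' → b ∈ E'
  /-- If `α` is an arrow from `E''` to `E'` and `β` is an arrow with `α β ∉ I`, then `β` starts in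
  a source. -/
  source : ∀ ⦃a b c : V⦄ (β : a ⟶ b) (α : b ⟶ c), b ∈ E'' → c ∈ E' →
    of K ⟨a, c, β.toPath.comp α.toPath⟩ ∉ I → IsSource a

section Corner

variable (I : Ideal (PathAlgebra K V)) [I.IsTwoSided] (E : Finset V)

/-- The sum of the primitive idempotents of `K V / I` that belong to the vertices in `E`. -/
def idem : PathAlgebra K V ⧸ I := Ideal.Quotient.mk I (vertexSum K E)

theorem isIdempotentElem_idem : IsIdempotentElem (idem I E) := by
  rw [IsIdempotentElem, idem, ← map_mul, vertexSum_mul_self]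

/-- The algebra `e (K V / I) e`, where `e` is the sum of the primitive idempotents in `E`. -/
abbrev CornerAlg : Type u := (isIdempotentElem_idem I E).Corner

/-- The element `e x e` of the corner algebra. -/
def toCorner (x : PathAlgebra K V ⧸ I) : CornerAlg I E := ⟨idem I E * x * idem I E, x, rfl⟩

end Corner

theorem IsStackingPartition.path {I : Ideal (PathAlgebra K V)} {E' E'' : Finset V}
    (h : IsStackingPartition I E' E'') {a b : V} (p : Quiver.Path a b) (ha : a ∈ E') : b ∈ E' := by
  induction p with
  | nil => exact ha
  | cons _ f ih => exact h.arrow f ih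

/-- In a stacking partition, `e'' x e'' = e'' x` for all `x`. -/
theorem IsStackingPartition.idem_mul {I : Ideal (PathAlgebra K V)} [I.IsTwoSided]
    {E' E'' : Finset V} (h : IsStackingPartition I E' E'') (x : PathAlgebra K V ⧸ I) :
    idem I E'' * x * idem I E'' = idem I E'' * x := by
  obtain ⟨x, rfl⟩ := Ideal.Quotient.mk_surjective x
  rw [idem, ← map_mul, ← map_mul]
  congr 1
  refine LinearMap.congr_fun (f := ((mulLin K V).flip (vertexSum K E'')).comp
    (mulLin K V (vertexSum K E''))) (g := mulLin K V (vertexSum K E'')) (hom_ext fun p => ?_) x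
  change vertexSum K E'' * of K p * vertexSum K E'' = vertexSum K E'' * of K p
  rw [vertexSum_mul_of]
  split_ifs with hp
  · rw [of_mul_vertexSum, if_pos]
    refine (h.cover p.1).resolve_left fun h1 => ?_
    exact Finset.disjoint_left.1 h.disjoint (h.path p.2.2 h1) hp
  · rw [zero_mul]

/-- For a stacking partition, the surjective ring homomorphism `x ↦ e'' x e''` from `Λ = K V / I`
to `Λ'' = e'' Λ e''`. Its kernel is the ideal `e' Λ`; every `Λ''`-module is a `Λ`-module along it,
namely the one on which `e'` acts as zero. -/
def IsStackingPartition.proj {I : Ideal (PathAlgebra K V)} [I.IsTwoSided] {E' E'' : Finset V}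
    (h : IsStackingPartition I E' E'') : (PathAlgebra K V ⧸ I) →+* CornerAlg I E'' where
  toFun := toCorner I E''
  map_one' := Subtype.ext (by
    change idem I E'' * 1 * idem I E'' = idem I E''
    rw [mul_one, isIdempotentElem_idem])
  map_mul' x y := Subtype.ext (by
    change idem I E'' * (x * y) * idem I E'' =
      (idem I E'' * x * idem I E'') * (idem I E'' * y * idem I E'')
    rw [h.idem_mul, h.idem_mul, h.idem_mul, ← mul_assoc, ← mul_assoc, h.idem_mul])
  map_zero' := Subtype.ext (by
    change idem I E'' * 0 * idem I E'' = 0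
    rw [mul_zero, zero_mul])
  map_add' x y := Subtype.ext (by
    change idem I E'' * (x + y) * idem I E'' =
      idem I E'' * x * idem I E'' + idem I E'' * y * idem I E''
    rw [mul_add, add_mul])

end Relations

/-! ### Homological notions -/

section Homological

/-- For an idempotent `e` of `R` and a left `R`-module `M`, the subgroup `e M` of `M`. -/
def cornerPart {R : Type u} [Ring R] {e : R} (_ : IsIdempotentElem e) (M : Type u) [AddCommGroup M]
    [Module R M] : AddSubgroup M where
  carrier := {x | e • x = x}
  zero_mem' := smul_zero e
  add_mem' {x y} hx hy := by
    change e • (x + y) = x + y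
    rw [smul_add, show e • x = x from hx, show e • y = y from hy]
  neg_mem' {x} hx := by
    change e • (-x) = -x
    rw [smul_neg, show e • x = x from hx]

/-- `e M` is a left module over `e R e`, by restriction of the action of `R` on `M`. -/
instance {R : Type u} [Ring R] {e : R} (he : IsIdempotentElem e) (M : Type u) [AddCommGroup M]
    [Module R M] : Module he.Corner (cornerPart he M) where
  smul r x := ⟨r.1 • x.1, by
    change e • (r.1 • x.1) = r.1 • x.1
    rw [smul_smul, ((Subsemigroup.mem_corner_iff he).1 r.2).1]⟩
  one_smul x := Subtype.ext x.2
  mul_smul r s x := Subtype.ext (mul_smul r.1 s.1 x.1)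
  smul_zero r := Subtype.ext (smul_zero r.1)
  smul_add r x y := Subtype.ext (smul_add r.1 x.1 y.1)
  add_smul r s x := Subtype.ext (add_smul r.1 s.1 x.1)
  zero_smul x := Subtype.ext (zero_smul R x.1)

variable {R : Type u} [Ring R]

/-- A projective cover: a surjection from a projective module with superfluous kernel. -/
structure IsProjectiveCover {P M : ModuleCat.{u} R} (f : P →ₗ[R] M) : Prop where
  projective : Module.Projective R P
  surjective : Function.Surjective f
  superfluous : ∀ L : Submodule R P, L ⊔ LinearMap.ker f = ⊤ → L = ⊤

/-- `X` is (isomorphic to) the `n`-th syzygy `Ωⁿ(M)`, formed by means of projective covers. -/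
def IsSyzygy : ℕ → ModuleCat.{u} R → ModuleCat.{u} R → Prop
  | 0, M, X => Nonempty (M ≅ X)
  | n + 1, M, X => ∃ (P : ModuleCat.{u} R) (f : P →ₗ[R] M),
      IsProjectiveCover f ∧ IsSyzygy n (ModuleCat.of R (LinearMap.ker f)) X

variable (R) in
/-- The left little finitistic dimension: the supremum of the projective dimensions of the
finitely generated left modules of finite projective dimension. -/
def finDim : WithBot ℕ∞ :=
  ⨆ (M : ModuleCat.{u} R) (_ : Module.Finite R M) (_ : projectiveDimension M < ⊤),
    projectiveDimension M

end Homological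

section Critical

variable {K V : Type u} [Field K] [Quiver.{u} V] [Fintype V]

/-- A path of the full subquiver on `E` is critical (for the algebra `e Λ e`, where `Λ = K V / I`)
if it is nonzero in `Λ`, of positive length, starts in a non-source of the subquiver, and generates
a left ideal of `e Λ e` of finite projective dimension. -/
structure IsCritical (I : Ideal (PathAlgebra K V)) [I.IsTwoSided] (E : Finset V)
    (p : TotalPath (FullSubquiver E)) : Prop where
  nontrivial : of K (inclPath E p) ∉ I
  length_pos : 0 < p.2.2.length
  start : ¬ IsSource p.1
  finite : projectiveDimension (ModuleCat.of (CornerAlg I E) (Ideal.span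
    {toCorner I E (Ideal.Quotient.mk I (of K (inclPath E p)))} : Ideal (CornerAlg I E))) < ⊤

/-- A vertex of `E` is homogeneous if all arrows starting in it end in `E`. -/
def IsHomogeneous (E : Finset V) (v : FullSubquiver E) : Prop :=
  ∀ w : V, (v.1 ⟶ w) → w ∈ E

end Critical

end Stacks

end

/-! The core is a fact about the monomial algebra Λ''. If a second syzygy `X` over Λ'' needs a
generator at a vertex `v`, then some left ideal Λ''p is a direct summand of `X`, where `p` is a
nonzero path of positive length that ends in `v` and starts in a non-source
(`PathBasis.exists_path_retract`, `PathBasis.exists_path_of_notMem_rad_smul`). If `X` has finite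
projective dimension, so has Λ''p; hence `p` is critical and `v` is homogeneous. Condition (b) then
kills all paths from `v` to E', so Λv → Λ''v is bijective (`IsStackingPartition.mul_vertex_eq_zero`)
and the Λ''-projective cover of `X` is projective over Λ as well. Its kernel is again a second
syzygy, and induction gives pd over Λ ≤ pd over Λ'' (`PathBasis.restrictPdLT_ker`). The reverse
inequality holds because M ↦ e''M is exact, preserves projectives (e''Λ = e''Λe'') and undoes
restriction (`PdLT.cornerPart`, `IsStackingPartition.cornerPartRestrict`).

To find the summand, embed `X` in a free module `F`, inside the radical and with torsionless
quotient. Linear maps F → Λ'' multiply paths on the right, so they prolong them at the start only;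
therefore `X` can be cut along terminal subpaths (`PathBasis.projF_mem`). A generator at `v` forces
an element `g` of `X`, all of whose terms end with one path `p`, whose leading coefficients do not
arise by multiplying an element of `X` by the last arrow of `p` (`PathBasis.exists_lift_free`). A
functional that separates `g` from rad X on the terminal subpaths of `p` extends to a linear map
from `X` to Λ''p, which splits the map p ↦ g up to an automorphism.

For the last claim, the same argument applies to e''Ω²N. In 0 → e'Ω²N → Ω²N → e''Ω²N → 0 the left
term is a finitely generated Λ'-module with the same projective dimension over Λ, because Λe' =
e'Λe'; once finite, it is at most fin dim Λ'. So above that bound the projective dimension of e''N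
controls that of N (`IsStackingPartition.pdLT_of_pdLT_cornerPart`). -/

namespace Stacks

/-! ### Projective dimension of modules -/

section ProjectiveDimension

variable {R : Type u} [Ring R]

variable (R) in
/-- The projective dimension of the module `M` is less than `n`. -/
abbrev PdLT (M : Type u) [AddCommGroup M] [Module R M] (n : ℕ) : Prop :=
  HasProjectiveDimensionLT (ModuleCat.of R M) n

variable {M N P : Type u} [AddCommGroup M] [Module R M] [AddCommGroup N] [Module R N]
  [AddCommGroup P] [Module R P]

theorem pdLT_zero_iff : PdLT R M 0 ↔ Subsingleton M := by
  rw [PdLT, hasProjectiveDimensionLT_zero_iff_isZero, ModuleCat.isZero_iff_subsingleton]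

theorem pdLT_one_iff : PdLT R M 1 ↔ Module.Projective R M := by
  rw [PdLT, ← projective_iff_hasProjectiveDimensionLT_one]
  exact (IsProjective.iff_projective M).symm

theorem PdLT.mono {m n : ℕ} (h : PdLT R M m) (hmn : m ≤ n) : PdLT R M n :=
  hasProjectiveDimensionLT_of_ge _ m n hmn

/-- The shift starts at `n + 1` on the right: a projective `M` has projective dimension less than 1
even if the kernel of `f` is nonzero. -/
theorem pdLT_ker_iff [Module.Projective R P] {f : P →ₗ[R] M} (hf : Function.Surjective f)
    (n : ℕ) : PdLT R M (n + 2) ↔ PdLT R (LinearMap.ker f) (n + 1) :=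
  (LinearMap.shortExact_shortComplexKer hf).hasProjectiveDimensionLT_X₃_iff n
    ((IsProjective.iff_projective P).1 inferInstance)

theorem pdLT_congr (e : M ≃ₗ[R] N) (n : ℕ) : PdLT R M n ↔ PdLT R N n :=
  ⟨fun _ => hasProjectiveDimensionLT_of_iso e.toModuleIso n,
    fun _ => hasProjectiveDimensionLT_of_iso e.symm.toModuleIso n⟩

/-- A module from which one passes to `N` and back by a bijection is a retract of `N`. -/
theorem PdLT.of_bijective {n : ℕ} (h : PdLT R N n) (i : M →ₗ[R] N) (r : N →ₗ[R] M)
    (hri : Function.Bijective (r ∘ₗ i)) : PdLT R M n := by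
  let e := LinearEquiv.ofBijective (r ∘ₗ i) hri
  let ρ : Retract (ModuleCat.of R M) (ModuleCat.of R N) :=
    { i := ModuleCat.ofHom i
      r := ModuleCat.ofHom (e.symm.toLinearMap ∘ₗ r)
      retract := by
        ext x
        exact e.symm_apply_apply x }
  exact ρ.hasProjectiveDimensionLT n

end ProjectiveDimension

/-! ### Restriction of scalars -/

section Restriction

variable {R S : Type u} [Ring R] [Ring S] (f : R →+* S)

/-- The projective dimension of `M`, as a module along `f`, is less than `n`. -/
abbrev RestrictPdLT (M : Type u) [AddCommGroup M] [Module S M] (n : ℕ) : Prop :=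
  HasProjectiveDimensionLT ((ModuleCat.restrictScalars f).obj (ModuleCat.of S M)) n

variable {M N P : Type u} [AddCommGroup M] [Module S M] [AddCommGroup N] [Module S N]
  [AddCommGroup P] [Module S P]

theorem restrictPdLT_zero_iff : RestrictPdLT f M 0 ↔ Subsingleton M := by
  rw [RestrictPdLT, hasProjectiveDimensionLT_zero_iff_isZero, ModuleCat.isZero_iff_subsingleton]
  rfl

/-- Only the restriction of `P` along `f` has to be projective, so a resolution over `S` can be used
over `R` as soon as its terms are `R`-projective. -/
theorem restrictPdLT_ker_iff (hP : RestrictPdLT f P 1) {g : P →ₗ[S] M}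
    (hg : Function.Surjective g) (n : ℕ) :
    RestrictPdLT f M (n + 2) ↔ RestrictPdLT f (LinearMap.ker g) (n + 1) :=
  have h := LinearMap.shortExact_shortComplexKer hg
  (ModuleCat.shortComplex_shortExact (g.shortComplexKer.map (ModuleCat.restrictScalars f))
    (show Function.Exact g.shortComplexKer.f g.shortComplexKer.g from
      (ShortComplex.ShortExact.moduleCat_exact_iff_function_exact _).1 h.exact)
    h.moduleCat_injective_f h.moduleCat_surjective_g).hasProjectiveDimensionLT_X₃_iff n
      (projective_iff_hasProjectiveDimensionLT_one.2 hP)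

theorem RestrictPdLT.of_rightInverse {n : ℕ} (h : RestrictPdLT f N n) (i : M →ₗ[S] N)
    (r : N →ₗ[S] M) (hri : r ∘ₗ i = LinearMap.id) : RestrictPdLT f M n := by
  let ρ : Retract (ModuleCat.of S M) (ModuleCat.of S N) :=
    { i := ModuleCat.ofHom i
      r := ModuleCat.ofHom r
      retract := by
        ext x
        exact LinearMap.congr_fun hri x }
  exact (ρ.map (ModuleCat.restrictScalars f)).hasProjectiveDimensionLT n

/-- If `f` maps `R e` bijectively to `S f(e)` for each of the idempotents `e i`, then the direct sum
of the modules `S f(e i)` is projective over `R`. -/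
theorem restrictPdLT_dfinsupp {ι : Type u} (hf : Function.Surjective f) (e : ι → R)
    (he : ∀ i, IsIdempotentElem (e i)) (hinj : ∀ i x, f (x * e i) = 0 → x * e i = 0) :
    RestrictPdLT f (Π₀ i, (Ideal.span {f (e i)} : Ideal S)) 1 := by
  have hproj (i : ι) : Module.Projective R (Ideal.span {e i} : Ideal R) :=
    .of_split (Ideal.span {e i} : Ideal R).subtype
      ((LinearMap.toSpanSingleton R R (e i)).codRestrict _ fun x =>
        Ideal.mul_mem_left _ x (Ideal.mem_span_singleton_self _)) <| by
      ext x
      obtain ⟨y, hy⟩ := Ideal.mem_span_singleton'.1 x.2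
      change x.1 * e i = x.1
      rw [← hy, mul_assoc, he i]
  let φ (i : ι) : (Ideal.span {e i} : Ideal R) →+ (Ideal.span {f (e i)} : Ideal S) :=
    { toFun x := ⟨f x.1, by
        obtain ⟨y, hy⟩ := Ideal.mem_span_singleton'.1 x.2
        rw [← hy, map_mul]
        exact Ideal.mul_mem_left _ _ (Ideal.mem_span_singleton_self _)⟩
      map_zero' := Subtype.ext (map_zero f)
      map_add' x y := Subtype.ext (map_add f _ _) }
  have hφ (i : ι) : Function.Bijective (φ i) := by
    constructor
    · refine (injective_iff_map_eq_zero _).2 fun x hx => Subtype.ext ?_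
      obtain ⟨y, hy⟩ := Ideal.mem_span_singleton'.1 x.2
      rw [ZeroMemClass.coe_zero, ← hy]
      exact hinj i y (by rw [hy]; exact congrArg Subtype.val hx)
    · rintro ⟨x, hx⟩
      obtain ⟨y, rfl⟩ := Ideal.mem_span_singleton'.1 hx
      obtain ⟨y, rfl⟩ := hf y
      exact ⟨⟨y * e i, Ideal.mul_mem_left _ y (Ideal.mem_span_singleton_self _)⟩,
        Subtype.ext (map_mul f _ _)⟩
  -- The bijections `φ i` are merely additive; linearity over `R` appears once the target is an
  -- `R`-module along `f`.
  let Φ : (Π₀ i, (Ideal.span {e i} : Ideal R)) →ₗ[R]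
      (ModuleCat.restrictScalars f).obj
        (ModuleCat.of S (Π₀ i, (Ideal.span {f (e i)} : Ideal S))) :=
    { toFun x := DFinsupp.mapRange.addMonoidHom φ x
      map_add' x y := map_add (DFinsupp.mapRange.addMonoidHom φ) x y
      map_smul' r x := by
        change DFinsupp.mapRange.addMonoidHom φ (r • x) =
          f r • DFinsupp.mapRange.addMonoidHom φ x
        refine DFinsupp.ext fun i => Subtype.ext ?_
        exact map_mul f r (x i).1 }
  have hΦ : Function.Bijective Φ :=
    ⟨(DFinsupp.mapRange_injective _ fun i => map_zero (φ i)).2 fun i => (hφ i).1,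
      (DFinsupp.mapRange_surjective _ fun i => map_zero (φ i)).2 fun i => (hφ i).2⟩
  have : PdLT R (Π₀ i, (Ideal.span {e i} : Ideal R)) 1 := pdLT_one_iff.2 inferInstance
  exact hasProjectiveDimensionLT_of_iso (LinearEquiv.ofBijective Φ hΦ).toModuleIso 1

end Restriction

/-! ### Corners of modules -/

section Corner

variable {R : Type u} [Ring R] {e : R} (he : IsIdempotentElem e)
  {M N P : Type u} [AddCommGroup M] [Module R M] [AddCommGroup N] [Module R N]
  [AddCommGroup P] [Module R P]

/-- The element `e r e` of the corner. -/
def cornerMk (r : R) : he.Corner := ⟨e * r * e, r, rfl⟩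

theorem coe_cornerMk_smul (r : R) (x : cornerPart he M) :
    ((cornerMk he r • x : cornerPart he M) : M) = (e * r * e) • (x : M) := rfl

theorem smul_mem_cornerPart (x : M) : e • x ∈ cornerPart he M := by
  change e • e • x = e • x
  rw [smul_smul, he]

/-- The restriction of a linear map to the corners. -/
def cornerMap (f : M →ₗ[R] N) : cornerPart he M →ₗ[he.Corner] cornerPart he N where
  toFun x := ⟨f x.1, by
    change e • f x.1 = f x.1
    rw [← map_smul, show e • x.1 = x.1 from x.2]⟩
  map_add' x y := Subtype.ext (map_add f _ _)
  map_smul' c x := Subtype.ext (map_smul f _ _)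

theorem coe_cornerMap (f : M →ₗ[R] N) (x : cornerPart he M) :
    (cornerMap he f x : N) = f x := rfl

variable {he}

theorem cornerMap_surjective {f : M →ₗ[R] N} (hf : Function.Surjective f) :
    Function.Surjective (cornerMap he f) := by
  intro y
  obtain ⟨x, hx⟩ := hf y
  exact ⟨⟨e • x, smul_mem_cornerPart he x⟩,
    Subtype.ext (by rw [coe_cornerMap, map_smul, hx]; exact y.2)⟩

variable (he) in
/-- The corner of a kernel is the kernel on the corners. -/
def kerCornerMap (f : M →ₗ[R] N) :
    LinearMap.ker (cornerMap he f) ≃ₗ[he.Corner] cornerPart he (LinearMap.ker f) where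
  toFun x := ⟨⟨x.1.1, congrArg Subtype.val x.2⟩, Subtype.ext x.1.2⟩
  invFun y := ⟨⟨y.1.1, congrArg Subtype.val y.2⟩, Subtype.ext y.1.2⟩
  map_add' _ _ := rfl
  map_smul' _ _ := rfl

theorem pdLT_cornerPart_ker_iff (hP : PdLT he.Corner (cornerPart he P) 1) {f : P →ₗ[R] M}
    (hf : Function.Surjective f) (n : ℕ) :
    PdLT he.Corner (cornerPart he M) (n + 2) ↔
      PdLT he.Corner (cornerPart he (LinearMap.ker f)) (n + 1) := by
  have := pdLT_one_iff.1 hP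
  rw [pdLT_ker_iff (cornerMap_surjective hf), pdLT_congr (kerCornerMap he f)]

/-- Since `e R = e R e`, the corner of a free module is free over the corner ring. A splitting of
the free cover of `M` passes to corners by applying `x ↦ e x e` to coefficients. -/
theorem projective_cornerPart (h : ∀ x, e * x * e = e * x) [Module.Projective R M] :
    Module.Projective he.Corner (cornerPart he M) := by
  obtain ⟨i, hi⟩ := Module.projective_def'.1 (inferInstance : Module.Projective R M)
  let t : R →+ he.Corner :=
    { toFun x := ⟨e * x * e, x, rfl⟩
      map_zero' := Subtype.ext (by
        change e * 0 * e = 0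
        rw [mul_zero, zero_mul])
      map_add' x y := Subtype.ext (by
        change e * (x + y) * e = e * x * e + e * y * e
        rw [mul_add, add_mul]) }
  let j : cornerPart he M →ₗ[he.Corner] (M →₀ he.Corner) :=
    { toFun x := (i x.1).mapRange t (map_zero t)
      map_add' x y := by
        ext m
        change t (i (x.1 + y.1) m) = t (i x.1 m) + t (i y.1 m)
        rw [map_add, Finsupp.add_apply, map_add]
      map_smul' c x := by
        ext m
        change t (i (c.1 • x.1) m) = c * t (i x.1 m)
        rw [map_smul, Finsupp.smul_apply, smul_eq_mul]
        refine Subtype.ext ?_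
        change e * (c.1 * i x.1 m) * e = c.1 * (e * i x.1 m * e)
        obtain ⟨h1, h2⟩ := (Subsemigroup.mem_corner_iff he).1 c.2
        rw [← mul_assoc e, h1, ← mul_assoc, ← mul_assoc, h2] }
  let s : (M →₀ he.Corner) →ₗ[he.Corner] cornerPart he M :=
    Finsupp.linearCombination he.Corner fun x => ⟨e • x, smul_mem_cornerPart he x⟩
  refine .of_split j s (LinearMap.ext fun x => Subtype.ext ?_)
  have hi := LinearMap.congr_fun hi x.1
  rw [LinearMap.comp_apply, Finsupp.linearCombination_apply, LinearMap.id_apply] at hi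
  have hx : e • x.1 = x.1 := x.2
  change (cornerPart he M).subtype (Finsupp.linearCombination he.Corner _ _) = x.1
  rw [Finsupp.linearCombination_apply]
  change (cornerPart he M).subtype
    (((i x.1).mapRange t (map_zero t)).sum fun m c => c • ⟨e • m, smul_mem_cornerPart he m⟩) = x.1
  have h0 (m : M) :
      (0 : he.Corner) • (⟨e • m, smul_mem_cornerPart he m⟩ : cornerPart he M) = 0 :=
    Subtype.ext (zero_smul R (e • m))
  rw [Finsupp.sum_mapRange_index h0, Finsupp.sum, map_sum]
  conv_rhs => rw [← hx, ← hi, Finsupp.sum, Finset.smul_sum]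
  refine Finset.sum_congr rfl fun m _ => ?_
  change (e * i x.1 m * e) • e • m = e • i x.1 m • m
  rw [smul_smul, mul_assoc, he, h, mul_smul]

/-- Passing to corners is exact and, by `projective_cornerPart`, preserves projectives, so it takes
resolutions to resolutions. -/
theorem PdLT.cornerPart (h : ∀ x, e * x * e = e * x) {n : ℕ} (hM : PdLT R M n) :
    PdLT he.Corner (cornerPart he M) n := by
  induction n using Nat.twoStepInduction generalizing M with
  | zero =>
    have := pdLT_zero_iff.1 hM
    exact pdLT_zero_iff.2 inferInstance
  | one =>
    have := pdLT_one_iff.1 hM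
    exact pdLT_one_iff.2 (projective_cornerPart h)
  | more n _ ih =>
    have hf : Function.Surjective (Finsupp.linearCombination R (id : M → M)) :=
      Finsupp.linearCombination_id_surjective R M
    rw [pdLT_cornerPart_ker_iff (pdLT_one_iff.2 (projective_cornerPart h)) hf]
    exact ih ((pdLT_ker_iff hf n).1 hM)

/-- As `R e = e R e`, a module fixed by `e` is covered by copies of `R e`, again fixed by `e`. Such
a cover is projective over `R` and, seen in the corner, over `e R e`, so both dimensions are
computed by the same kernels. -/
theorem pdLT_cornerPart_iff (h : ∀ x, e * x * e = x * e) (hM : ∀ m : M, e • m = m) (n : ℕ) :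
    PdLT R M n ↔ PdLT he.Corner (cornerPart he M) n := by
  have hsub : Subsingleton M ↔ Subsingleton (Stacks.cornerPart he M) :=
    ⟨fun _ => inferInstance, fun _ => ⟨fun x y =>
      congrArg Subtype.val (Subsingleton.elim (⟨x, hM x⟩ : Stacks.cornerPart he M) ⟨y, hM y⟩)⟩⟩
  induction n generalizing M with
  | zero => rw [pdLT_zero_iff, pdLT_zero_iff, hsub]
  | succ n ih =>
  let A : Ideal R := Ideal.span {e}
  have heA : e ∈ A := Ideal.mem_span_singleton_self _
  have hA (x : R) (hx : x ∈ A) : x * e = x ∧ e * x = x := by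
    obtain ⟨y, rfl⟩ := Ideal.mem_span_singleton'.1 hx
    exact ⟨by rw [mul_assoc, he], by rw [← mul_assoc, h]⟩
  let F := Π₀ _ : M, A
  have hproj : Module.Projective R A :=
    .of_split A.subtype ((LinearMap.toSpanSingleton R R e).codRestrict _ fun x =>
      Ideal.mul_mem_left _ x heA) (LinearMap.ext fun x => Subtype.ext (hA x.1 x.2).1)
  have hF (x : F) : e • x = x := DFinsupp.ext fun m => Subtype.ext (hA _ (x m).2).2
  have hcF : Module.Projective he.Corner (Stacks.cornerPart he F) := by
    let j : Stacks.cornerPart he F →ₗ[he.Corner] (Π₀ _ : M, he.Corner) :=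
      { toFun x := DFinsupp.mapRange (β₂ := fun _ : M => he.Corner)
          (fun _ (z : A) => ⟨z.1, (Subsemigroup.mem_corner_iff he).2 (hA z.1 z.2).symm⟩)
          (fun _ => rfl) x.1
        map_add' x y := DFinsupp.ext fun m => rfl
        map_smul' c x := DFinsupp.ext fun m => rfl }
    let s : (Π₀ _ : M, he.Corner) →ₗ[he.Corner] Stacks.cornerPart he F :=
      { toFun y := ⟨DFinsupp.mapRange (β₂ := fun _ : M => A)
          (fun _ c => ⟨c.1, by
            rw [← ((Subsemigroup.mem_corner_iff he).1 c.2).2]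
            exact Ideal.mul_mem_left _ _ heA⟩) (fun _ => rfl) y, hF _⟩
        map_add' x y := Subtype.ext (DFinsupp.ext fun m => rfl)
        map_smul' c x := Subtype.ext (DFinsupp.ext fun m => rfl) }
    exact .of_split j s (LinearMap.ext fun x => Subtype.ext (DFinsupp.ext fun m => rfl))
  classical
  let g : F →ₗ[R] M :=
    DFinsupp.lsum ℕ fun m => (LinearMap.toSpanSingleton R M m).comp A.subtype
  have hg : Function.Surjective g := fun m =>
    ⟨DFinsupp.single m ⟨e, heA⟩, by
      rw [DFinsupp.lsum_single]
      exact hM m⟩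
  match n with
  | 0 =>
    rw [pdLT_one_iff, pdLT_one_iff, Module.Projective.iff_split_of_projective g hg,
      Module.Projective.iff_split_of_projective _ (cornerMap_surjective (he := he) hg)]
    constructor
    · rintro ⟨i, hi⟩
      exact ⟨cornerMap he i, LinearMap.ext fun x => Subtype.ext (LinearMap.congr_fun hi x.1)⟩
    · rintro ⟨i, hi⟩
      refine ⟨
        { toFun x := (i ⟨x, hM x⟩).1
          map_add' x y := congrArg Subtype.val (map_add i ⟨x, hM x⟩ ⟨y, hM y⟩)
          map_smul' r x := ?_ }, LinearMap.ext fun x =>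
            congrArg Subtype.val (LinearMap.congr_fun hi ⟨x, hM x⟩)⟩
      -- On modules fixed by `e` the element `r` acts as `e r e` does, so a splitting over the
      -- corner is `R`-linear.
      have h1 : (⟨r • x, hM _⟩ : Stacks.cornerPart he M) =
          cornerMk he r • ⟨x, hM x⟩ := Subtype.ext (by
        rw [coe_cornerMk_smul, h, mul_smul, hM])
      change (i ⟨r • x, hM _⟩).1 = r • (i ⟨x, hM x⟩).1
      rw [h1, map_smul, coe_cornerMk_smul, h, mul_smul, hF]
  | n + 1 =>
    rw [pdLT_ker_iff hg, pdLT_cornerPart_ker_iff (pdLT_one_iff.2 hcF) hg]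
    refine ih (M := LinearMap.ker g) (fun x => Subtype.ext (hF x.1)) ?_
    exact ⟨fun _ => inferInstance, fun _ => ⟨fun x y => congrArg Subtype.val
      (Subsingleton.elim (⟨x, Subtype.ext (hF x.1)⟩ : Stacks.cornerPart he (LinearMap.ker g))
        ⟨y, Subtype.ext (hF y.1)⟩)⟩⟩

theorem finite_cornerPart (h : ∀ x, e * x * e = x * e) (hM : ∀ m : M, e • m = m)
    [Module.Finite R M] : Module.Finite he.Corner (cornerPart he M) := by
  obtain ⟨s, hs⟩ := Module.Finite.fg_top (R := R) (M := M)
  classical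
  refine ⟨⟨s.image fun x => ⟨x, hM x⟩, eq_top_iff.2 ?_⟩⟩
  rintro ⟨x, hx⟩ -
  have hx' : x ∈ Submodule.span R (s : Set M) := hs ▸ Submodule.mem_top
  induction hx' using Submodule.span_induction with
  | mem x hxs => exact Submodule.subset_span (Finset.mem_coe.2 (Finset.mem_image_of_mem _ hxs))
  | zero => exact Submodule.zero_mem _
  | add x y _ _ ihx ihy => exact Submodule.add_mem _ (ihx (hM x)) (ihy (hM y))
  | smul r x _ ih =>
    have h1 : (⟨r • x, hx⟩ : cornerPart he M) = cornerMk he r • ⟨x, hM x⟩ :=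
      Subtype.ext (by rw [coe_cornerMk_smul, h, mul_smul, hM])
    exact h1 ▸ Submodule.smul_mem _ _ (ih (hM x))

end Corner

/-! ### Rings spanned by paths -/

/-- A description of the `K`-algebra `R` as a quotient of the path algebra of `W` in which all long
paths vanish: the image of each path in `R`. -/
structure PathSystem (K W R : Type u) [Field K] [Quiver.{u} W] [Fintype W] [Ring R]
    [Algebra K R] where
  path : TotalPath W → R
  path_mul_path : ∀ {a b c : W} (p : Quiver.Path b c) (q : Quiver.Path a b),
    path ⟨b, c, p⟩ * path ⟨a, b, q⟩ = path ⟨a, c, q.comp p⟩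
  path_mul_path_of_ne : ∀ {p q : TotalPath W}, p.1 ≠ q.2.1 → path p * path q = 0
  sum_path_nil : ∑ v, path ⟨v, v, Quiver.Path.nil⟩ = 1
  span_range_path : Submodule.span K (Set.range path) = ⊤
  exists_path_eq_zero : ∃ m : ℕ, ∀ p : TotalPath W, m ≤ p.2.2.length → path p = 0

namespace PathSystem

variable {K W R : Type u} [Field K] [Quiver.{u} W] [Fintype W] [Ring R] [Algebra K R]
  (S : PathSystem K W R)

theorem induction_on {p : R → Prop} (x : R) (path : ∀ q, p (S.path q)) (zero : p 0)
    (add : ∀ x y, p x → p y → p (x + y)) (smul : ∀ (c : K) x, p x → p (c • x)) : p x := by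
  have hx : x ∈ Submodule.span K (Set.range S.path) := S.span_range_path ▸ Submodule.mem_top
  induction hx using Submodule.span_induction with
  | mem x h =>
    obtain ⟨q, rfl⟩ := h
    exact path q
  | zero => exact zero
  | add x y _ _ hx hy => exact add x y hx hy
  | smul c x _ hx => exact smul c x hx

theorem hom_ext {M : Type*} [AddCommGroup M] [Module K M] {f g : R →ₗ[K] M}
    (h : ∀ p, f (S.path p) = g (S.path p)) : f = g := by
  refine LinearMap.ext fun x => ?_
  induction x using S.induction_on with
  | path q => exact h q
  | zero => rw [map_zero, map_zero]
  | add x y hx hy => rw [map_add, map_add, hx, hy]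
  | smul c x hx => rw [map_smul, map_smul, hx]

/-- The primitive idempotent of a vertex. -/
def vtx (v : W) : R := S.path ⟨v, v, Quiver.Path.nil⟩

theorem vtx_mul_path {a b : W} (p : Quiver.Path a b) :
    S.vtx b * S.path ⟨a, b, p⟩ = S.path ⟨a, b, p⟩ := S.path_mul_path _ _

theorem vtx_mul_path_of_ne {v : W} {p : TotalPath W} (h : v ≠ p.2.1) :
    S.vtx v * S.path p = 0 := S.path_mul_path_of_ne h

theorem path_mul_vtx {a b : W} (p : Quiver.Path a b) :
    S.path ⟨a, b, p⟩ * S.vtx a = S.path ⟨a, b, p⟩ := by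
  rw [vtx, S.path_mul_path, Quiver.Path.nil_comp]

theorem vtx_mul_vtx (v : W) : S.vtx v * S.vtx v = S.vtx v := S.vtx_mul_path _

theorem vtx_mul_vtx_of_ne {v w : W} (h : v ≠ w) : S.vtx v * S.vtx w = 0 :=
  S.path_mul_path_of_ne h

theorem sum_vtx : ∑ v, S.vtx v = 1 := S.sum_path_nil

theorem path_cons {a b c : W} (p : Quiver.Path a b) (α : b ⟶ c) :
    S.path ⟨a, c, p.cons α⟩ = S.path ⟨b, c, α.toPath⟩ * S.path ⟨a, b, p⟩ :=
  (S.path_mul_path α.toPath p).symm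

/-- The left ideal generated by the paths of length at least `n`. -/
def longIdeal (n : ℕ) : Ideal R := Ideal.span {x | ∃ p, n ≤ p.2.2.length ∧ S.path p = x}

theorem path_mem_longIdeal {n : ℕ} {p : TotalPath W} (h : n ≤ p.2.2.length) :
    S.path p ∈ S.longIdeal n := Ideal.subset_span ⟨p, h, rfl⟩

/-- Prolonging a path at its start does not shorten it, so this left ideal is two-sided. -/
theorem mul_mem_longIdeal {n : ℕ} {x : R} (hx : x ∈ S.longIdeal n) (y : R) :
    x * y ∈ S.longIdeal n := by
  induction hx using Submodule.span_induction with
  | mem x h =>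
    obtain ⟨p, hp, rfl⟩ := h
    induction y using S.induction_on with
    | path q =>
      by_cases hpq : p.1 = q.2.1
      · obtain ⟨a, b, p⟩ := p
        obtain ⟨c, d, q⟩ := q
        obtain rfl : a = d := hpq
        rw [S.path_mul_path]
        refine S.path_mem_longIdeal (hp.trans ?_)
        rw [Quiver.Path.length_comp]
        exact Nat.le_add_left _ _
      · rw [S.path_mul_path_of_ne hpq]
        exact zero_mem _
    | zero => rw [mul_zero]; exact zero_mem _
    | add x y hx hy => rw [mul_add]; exact add_mem hx hy
    | smul c x hx =>
      rw [mul_smul_comm]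
      exact Submodule.smul_of_tower_mem _ c hx
  | zero => rw [zero_mul]; exact zero_mem _
  | add x z _ _ hx hz => rw [add_mul]; exact add_mem hx hz
  | smul r x _ hx => rw [smul_eq_mul, mul_assoc]; exact Ideal.mul_mem_left _ r hx

/-- The ideal generated by the arrows. -/
def rad : Ideal R := S.longIdeal 1

theorem path_mem_rad {p : TotalPath W} (h : 0 < p.2.2.length) : S.path p ∈ S.rad :=
  S.path_mem_longIdeal h

theorem mul_mem_rad {x : R} (hx : x ∈ S.rad) (y : R) : x * y ∈ S.rad := S.mul_mem_longIdeal hx y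

theorem mul_mem_longIdeal_succ {n : ℕ} {x y : R} (hx : x ∈ S.longIdeal n) (hy : y ∈ S.rad) :
    x * y ∈ S.longIdeal (n + 1) := by
  induction hy using Submodule.span_induction generalizing x with
  | mem y h =>
    obtain ⟨q, hq, rfl⟩ := h
    induction hx using Submodule.span_induction with
    | mem x h =>
      obtain ⟨p, hp, rfl⟩ := h
      by_cases hpq : p.1 = q.2.1
      · obtain ⟨a, b, p⟩ := p
        obtain ⟨c, d, q⟩ := q
        obtain rfl : a = d := hpq
        rw [S.path_mul_path]
        refine S.path_mem_longIdeal ?_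
        rw [Quiver.Path.length_comp, add_comm]
        exact add_le_add hq hp
      · rw [S.path_mul_path_of_ne hpq]
        exact zero_mem _
    | zero => rw [zero_mul]; exact zero_mem _
    | add x z _ _ hx hz => rw [add_mul]; exact add_mem hx hz
    | smul r x _ hx => rw [smul_eq_mul, mul_assoc]; exact Ideal.mul_mem_left _ r hx
  | zero => rw [mul_zero]; exact zero_mem _
  | add y z _ _ hy hz => rw [mul_add]; exact add_mem (hy hx) (hz hx)
  | smul r y _ hy =>
    rw [smul_eq_mul, ← mul_assoc]
    exact hy (S.mul_mem_longIdeal hx r)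

theorem longIdeal_zero : S.longIdeal 0 = ⊤ := by
  rw [Ideal.eq_top_iff_one, ← S.sum_vtx]
  exact sum_mem fun v _ => S.path_mem_longIdeal (Nat.zero_le _)

theorem exists_longIdeal_eq_bot : ∃ m, S.longIdeal m = ⊥ := by
  obtain ⟨m, hm⟩ := S.exists_path_eq_zero
  refine ⟨m, eq_bot_iff.2 (Ideal.span_le.2 ?_)⟩
  rintro _ ⟨p, hp, rfl⟩
  exact hm p hp

theorem exists_sub_mem_rad (x : R) : ∃ c : W → K, x - ∑ v, c v • S.vtx v ∈ S.rad := by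
  classical
  induction x using S.induction_on with
  | path q =>
    obtain ⟨a, b, q⟩ := q
    by_cases hq : q.length = 0
    · obtain rfl := Quiver.Path.eq_of_length_zero q hq
      obtain rfl := Quiver.Path.eq_nil_of_length_zero q hq
      refine ⟨fun v => if v = a then 1 else 0, ?_⟩
      simp only [ite_smul, one_smul, zero_smul, Finset.sum_ite_eq', Finset.mem_univ, if_true]
      rw [vtx, sub_self]
      exact zero_mem _
    · refine ⟨0, ?_⟩
      simp only [Pi.zero_apply, zero_smul, Finset.sum_const_zero, sub_zero]
      exact S.path_mem_rad (Nat.pos_of_ne_zero hq)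
  | zero => exact ⟨0, by simp⟩
  | add x y hx hy =>
    obtain ⟨c, hc⟩ := hx
    obtain ⟨d, hd⟩ := hy
    refine ⟨c + d, ?_⟩
    simp only [Pi.add_apply, add_smul, Finset.sum_add_distrib]
    rw [add_sub_add_comm]
    exact add_mem hc hd
  | smul k x hx =>
    obtain ⟨c, hc⟩ := hx
    refine ⟨k • c, ?_⟩
    simp only [Pi.smul_apply, smul_assoc, ← Finset.smul_sum]
    rw [← smul_sub]
    exact Submodule.smul_of_tower_mem _ k hc

theorem exists_vtx_mul_sub_mem_rad (v : W) (x : R) :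
    ∃ c : K, S.vtx v * x - c • S.vtx v ∈ S.rad := by
  classical
  obtain ⟨c, hc⟩ := S.exists_sub_mem_rad x
  refine ⟨c v, ?_⟩
  have h := Ideal.mul_mem_left _ (S.vtx v) hc
  rw [mul_sub, Finset.mul_sum, Finset.sum_eq_single v] at h
  · rwa [mul_smul_comm, S.vtx_mul_vtx] at h
  · intro w _ hw
    rw [mul_smul_comm, S.vtx_mul_vtx_of_ne hw.symm, smul_zero]
  · exact fun h => absurd (Finset.mem_univ v) h

theorem exists_mul_vtx_sub_mem_rad (v : W) (x : R) :
    ∃ c : K, x * S.vtx v - c • S.vtx v ∈ S.rad := by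
  classical
  obtain ⟨c, hc⟩ := S.exists_sub_mem_rad x
  refine ⟨c v, ?_⟩
  have h := S.mul_mem_rad hc (S.vtx v)
  rw [sub_mul, Finset.sum_mul, Finset.sum_eq_single v] at h
  · rwa [smul_mul_assoc, S.vtx_mul_vtx] at h
  · intro w _ hw
    rw [smul_mul_assoc, S.vtx_mul_vtx_of_ne hw, smul_zero]
  · exact fun h => absurd (Finset.mem_univ v) h

/-! ### Nakayama's lemma and projective covers -/

section Modules

variable {M : Type u} [AddCommGroup M] [Module R M]

theorem sum_vtx_smul (x : M) : ∑ v, S.vtx v • x = x := by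
  rw [← Finset.sum_smul, S.sum_vtx, one_smul]

theorem longIdeal_smul_rad_smul_le (n : ℕ) (N : Submodule R M) :
    S.longIdeal n • S.rad • N ≤ S.longIdeal (n + 1) • N := by
  rw [← Submodule.mul_smul]
  exact Submodule.smul_mono_left
    (Ideal.mul_le.2 fun x hx y hy => S.mul_mem_longIdeal_succ hx hy)

/-- Nakayama's lemma without finiteness: the arrow ideal is nilpotent, so substituting `M = N + rad
M` into itself finitely often removes the radical term. -/
theorem eq_top_of_sup_rad_smul {N : Submodule R M} (h : N ⊔ S.rad • (⊤ : Submodule R M) = ⊤) :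
    N = ⊤ := by
  obtain ⟨m, hm⟩ := S.exists_longIdeal_eq_bot
  have key (k : ℕ) : N ⊔ S.longIdeal k • (⊤ : Submodule R M) = ⊤ := by
    induction k with
    | zero => rw [S.longIdeal_zero, Submodule.top_smul, sup_top_eq]
    | succ k ih =>
      refine eq_top_iff.2 ?_
      conv_lhs => rw [← ih]
      refine sup_le le_sup_left ?_
      conv_lhs => rw [← h]
      rw [Submodule.smul_sup]
      exact sup_le_sup Submodule.smul_le_right (S.longIdeal_smul_rad_smul_le k ⊤)
  have := key m
  rwa [hm, Submodule.bot_smul, sup_bot_eq] at this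

/-- A map of modules is superfluous if its kernel is contained in the radical. -/
theorem eq_top_of_sup_ker {N : Type u} [AddCommGroup N] [Module R N] {f : M →ₗ[R] N}
    (hf : LinearMap.ker f ≤ S.rad • ⊤) {L : Submodule R M} (hL : L ⊔ LinearMap.ker f = ⊤) :
    L = ⊤ :=
  S.eq_top_of_sup_rad_smul (top_le_iff.1 (hL.ge.trans (sup_le_sup le_rfl hf)))

/-- A superfluous submodule is contained in the radical. -/
theorem le_rad_smul_of_superfluous {N : Submodule R M}
    (hN : ∀ L : Submodule R M, L ⊔ N = ⊤ → L = ⊤) : N ≤ S.rad • ⊤ := by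
  intro x hx
  by_contra hxr
  obtain ⟨v, hv⟩ : ∃ v, S.vtx v • x ∉ S.rad • (⊤ : Submodule R M) := by
    by_contra! h
    exact hxr (S.sum_vtx_smul x ▸ sum_mem fun v _ => h v)
  let Q := M ⧸ (S.rad • (⊤ : Submodule R M))
  let π : M →ₗ[R] Q := (S.rad • (⊤ : Submodule R M)).mkQ
  let : Module K Q := Module.compHom Q (algebraMap K R)
  have hK (c : K) (y : Q) : c • y = algebraMap K R c • y := rfl
  have hu : π (S.vtx v • x) ≠ 0 := fun h => hv ((Submodule.Quotient.mk_eq_zero _).1 h)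
  obtain ⟨θ, hθ⟩ := Module.Projective.exists_dual_ne_zero K hu
  have hrad (r : R) (hr : r ∈ S.rad) (y : M) : π (r • y) = 0 :=
    (Submodule.Quotient.mk_eq_zero _).2 (Submodule.smul_mem_smul hr Submodule.mem_top)
  -- `L` is cut out by a functional on the `v`-part of `M / rad M`; it is a submodule because `v r`
  -- is a scalar multiple of `v` modulo the radical. Together with `N` it spans `M`, yet it misses
  -- `x`.
  let L : Submodule R M :=
    { carrier := {y | θ (π (S.vtx v • y)) = 0}
      zero_mem' := by
        change θ (π (S.vtx v • 0)) = 0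
        rw [smul_zero, map_zero, map_zero]
      add_mem' {y z} hy hz := by
        change θ (π (S.vtx v • (y + z))) = 0
        rw [smul_add, map_add, map_add, hy, hz, add_zero]
      smul_mem' r y hy := by
        change θ (π (S.vtx v • r • y)) = 0
        obtain ⟨c, hc⟩ := S.exists_vtx_mul_sub_mem_rad v r
        have h := hrad _ hc y
        rw [sub_smul, map_sub, sub_eq_zero, Algebra.smul_def, mul_smul, mul_smul,
          map_smul π (algebraMap K R c), ← hK] at h
        rw [h, map_smul, show θ (π (S.vtx v • y)) = 0 from hy, smul_zero] }
  have hL : L = ⊤ := by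
    refine hN L (eq_top_iff.2 fun y _ => ?_)
    let c : K := θ (π (S.vtx v • y)) / θ (π (S.vtx v • x))
    rw [← sub_add_cancel y (algebraMap K R c • S.vtx v • x)]
    refine Submodule.add_mem_sup ?_ (N.smul_mem _ (N.smul_mem _ hx))
    change θ (π (S.vtx v • (y - algebraMap K R c • S.vtx v • x))) = 0
    rw [smul_sub, map_sub, map_sub, smul_smul, ← Algebra.commutes, mul_smul, smul_smul (S.vtx v),
      S.vtx_mul_vtx, map_smul π (algebraMap K R c), ← hK, map_smul θ, smul_eq_mul,
      div_mul_cancel₀ _ hθ, sub_self]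
  have hxL : x ∈ L := hL ▸ Submodule.mem_top
  exact hθ hxL

/-- Modulo the nilpotent arrow ideal the algebra is semisimple, so superfluous means contained in
the radical. This is the form in which covers are used. -/
theorem isProjectiveCover_iff {P N : ModuleCat.{u} R} (f : P →ₗ[R] N) :
    IsProjectiveCover f ↔
      Module.Projective R P ∧ Function.Surjective f ∧ LinearMap.ker f ≤ S.rad • ⊤ :=
  ⟨fun h => ⟨h.projective, h.surjective, S.le_rad_smul_of_superfluous h.superfluous⟩,
    fun h => ⟨h.1, h.2.1, fun _ hL => S.eq_top_of_sup_ker h.2.2 hL⟩⟩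

theorem finite_of_ker_le {N : Type u} [AddCommGroup N] [Module R N] {f : M →ₗ[R] N}
    (hf : Function.Surjective f) (hker : LinearMap.ker f ≤ S.rad • ⊤) [Module.Finite R N] :
    Module.Finite R M := by
  classical
  obtain ⟨s, hs⟩ := Module.Finite.fg_top (R := R) (M := N)
  choose h hh using hf
  refine ⟨⟨s.image h, S.eq_top_of_sup_ker hker ?_⟩⟩
  rw [← Submodule.comap_map_eq, Submodule.map_span, Finset.coe_image, ← Set.image_comp,
    show ⇑f ∘ h = id from funext hh, Set.image_id, hs, Submodule.comap_top]

instance projective_span_vtx (v : W) : Module.Projective R (Ideal.span {S.vtx v} : Ideal R) :=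
  .of_split (Ideal.span {S.vtx v} : Ideal R).subtype
    ((LinearMap.toSpanSingleton R R (S.vtx v)).codRestrict _ fun x =>
      Ideal.mul_mem_left _ x (Ideal.mem_span_singleton_self _)) <| by
    ext x
    obtain ⟨y, hy⟩ := Ideal.mem_span_singleton'.1 x.2
    change x.1 * S.vtx v = x.1
    rw [← hy, mul_assoc, S.vtx_mul_vtx]

variable (M) in
/-- Every module has a projective cover by a direct sum of modules `R e`. -/
theorem exists_cover : ∃ (ι : Type u) (v : ι → W)
    (g : (Π₀ i, (Ideal.span {S.vtx (v i)} : Ideal R)) →ₗ[R] M),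
    Function.Surjective g ∧ LinearMap.ker g ≤ S.rad • ⊤ ∧
      ∀ i, ∃ m : M, S.vtx (v i) • m = m ∧ m ∉ S.rad • (⊤ : Submodule R M) := by
  classical
  let N : Submodule R M := S.rad • ⊤
  let Q := M ⧸ N
  let π : M →ₗ[R] Q := N.mkQ
  let : Module K Q := Module.compHom Q (algebraMap K R)
  have : IsScalarTower K R Q := ⟨fun c r x => by
    change (c • r) • x = algebraMap K R c • r • x
    rw [Algebra.smul_def, mul_smul]⟩
  have hK (c : K) (y : Q) : c • y = algebraMap K R c • y := rfl
  let E (v : W) : Q →ₗ[K] Q := Algebra.lsmul K K Q (S.vtx v)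
  have hE (v : W) (x : Q) : E v x = S.vtx v • x := rfl
  -- `Q` is the sum of its vertex parts `B v`; every vector of a `K`-basis of `B v`, lifted to `M`,
  -- contributes one summand `R v` to the cover.
  let B (v : W) : Submodule K Q := LinearMap.range (E v)
  have hB {v : W} {x : Q} (hx : x ∈ B v) : S.vtx v • x = x := by
    obtain ⟨y, rfl⟩ := hx
    rw [hE, smul_smul, S.vtx_mul_vtx]
  let b (v : W) := Module.Basis.ofVectorSpace K (B v)
  let ι := Σ v : W, Module.Basis.ofVectorSpaceIndex K (B v)
  have hm (i : ι) : ∃ m : M, π m = (b i.1 i.2 : Q) ∧ S.vtx i.1 • m = m := by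
    obtain ⟨m, hm⟩ := N.mkQ_surjective (b i.1 i.2 : Q)
    refine ⟨S.vtx i.1 • m, ?_, by rw [smul_smul, S.vtx_mul_vtx]⟩
    rw [map_smul]
    exact (congrArg _ hm).trans (hB (b i.1 i.2).2)
  choose m hm hvm using hm
  let g : (Π₀ i : ι, (Ideal.span {S.vtx i.1} : Ideal R)) →ₗ[R] M :=
    DFinsupp.lsum ℕ fun i => (LinearMap.toSpanSingleton R M (m i)).comp
      (Ideal.span {S.vtx i.1} : Ideal R).subtype
  have hg (i : ι) (x : (Ideal.span {S.vtx i.1} : Ideal R)) :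
      g (DFinsupp.single i x) = x.1 • m i := DFinsupp.lsum_single _ _ _ _
  -- Functionals dual to the classes of the `m i`: they show that a relation among the `m i` has its
  -- coefficients in the radical.
  let crd (i : ι) : Q →ₗ[K] K := ((b i.1).coord i.2).comp (E i.1).rangeRestrict
  have hcrd_self (i : ι) : crd i (π (m i)) = 1 := by
    obtain ⟨v, i⟩ := i
    have h1 : (E v).rangeRestrict (b v i : Q) = b v i := Subtype.ext (hB (b v i).2)
    rw [hm]
    change (b v).coord i ((E v).rangeRestrict (b v i : Q)) = _
    rw [h1, Module.Basis.coord_apply, Module.Basis.repr_self, Finsupp.single_eq_same]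
  have hcrd_ne (i j : ι) (hij : j ≠ i) : crd i (π (m j)) = 0 := by
    obtain ⟨v, i⟩ := i
    obtain ⟨w, j⟩ := j
    rw [hm]
    by_cases hvw : w = v
    · subst hvw
      have h1 : (E w).rangeRestrict (b w j : Q) = b w j := Subtype.ext (hB (b w j).2)
      change (b w).coord i ((E w).rangeRestrict (b w j : Q)) = _
      rw [h1, Module.Basis.coord_apply, Module.Basis.repr_self, Finsupp.single_eq_of_ne]
      exact fun h => hij (h ▸ rfl)
    · have h1 : (E v).rangeRestrict (b w j : Q) = 0 := Subtype.ext (by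
        change S.vtx v • (b w j : Q) = 0
        rw [← hB (b w j).2, smul_smul, S.vtx_mul_vtx_of_ne (Ne.symm hvw), zero_smul])
      change (b v).coord i ((E v).rangeRestrict (b w j : Q)) = _
      rw [h1, map_zero]
  refine ⟨ι, Sigma.fst, g, ?_, ?_, fun i => ⟨m i, hvm i, fun h => ?_⟩⟩
  · rw [← LinearMap.range_eq_top]
    refine S.eq_top_of_sup_rad_smul (eq_top_iff.2 fun x _ => ?_)
    let T : Submodule K Q :=
      { (LinearMap.range (π.comp g)).toAddSubmonoid with
        smul_mem' c x hx := (LinearMap.range (π.comp g)).smul_mem (algebraMap K R c) hx }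
    have hT (v : W) (y : B v) : (y : Q) ∈ T := by
      have hy := (b v).mem_span y
      induction hy using Submodule.span_induction with
      | mem y h =>
        obtain ⟨j, rfl⟩ := h
        refine ⟨DFinsupp.single ⟨v, j⟩ ⟨S.vtx v, Ideal.mem_span_singleton_self _⟩, ?_⟩
        rw [LinearMap.comp_apply, hg]
        exact (congrArg π (hvm ⟨v, j⟩)).trans (hm ⟨v, j⟩)
      | zero => exact T.zero_mem
      | add y z _ _ hy hz => exact T.add_mem hy hz
      | smul c y _ hy => exact T.smul_mem c hy
    have hx : π x ∈ T := by
      rw [← S.sum_vtx_smul (π x)]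
      exact sum_mem fun v _ => hT v ⟨_, π x, rfl⟩
    obtain ⟨y, hy⟩ := hx
    rw [← add_sub_cancel (g y) x]
    refine Submodule.add_mem_sup ⟨y, rfl⟩ ((Submodule.Quotient.mk_eq_zero _).1 ?_)
    change π (x - g y) = 0
    rw [map_sub, sub_eq_zero]
    exact hy.symm
  · intro y hy
    have h1 (i : ι) : ∃ c : K, (y i).1 - c • S.vtx i.1 ∈ S.rad := by
      obtain ⟨z, hz⟩ := Ideal.mem_span_singleton'.1 (y i).2
      rw [← hz]
      exact S.exists_mul_vtx_sub_mem_rad i.1 z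
    choose c hc using h1
    have h2 : ∑ i ∈ y.support, c i • π (m i) = 0 := by
      have h3 : π (g y) = 0 := by rw [hy, map_zero]
      rw [← DFinsupp.sum_single (f := y), DFinsupp.sum, map_sum, map_sum] at h3
      rw [← h3]
      refine Finset.sum_congr rfl fun i _ => ?_
      rw [hg]
      have h4 : π (((y i).1 - c i • S.vtx i.1) • m i) = 0 :=
        (Submodule.Quotient.mk_eq_zero _).2 (Submodule.smul_mem_smul (hc i) Submodule.mem_top)
      rw [sub_smul, map_sub, sub_eq_zero, Algebra.smul_def, mul_smul, hvm,
        map_smul π (algebraMap K R _)] at h4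
      exact h4.symm
    have h5 (i : ι) (hi : i ∈ y.support) : c i = 0 := by
      have h6 := congrArg (crd i) h2
      rwa [map_sum, map_zero, Finset.sum_eq_single i, map_smul, hcrd_self, smul_eq_mul,
        mul_one] at h6
      · intro j _ hj
        rw [map_smul, hcrd_ne i j hj, smul_zero]
      · exact fun h => absurd hi h
    rw [← DFinsupp.sum_single (f := y)]
    refine sum_mem fun i hi => ?_
    have h6 : (y i).1 ∈ S.rad := by
      have := hc i
      rwa [h5 i hi, zero_smul, sub_zero] at this
    have h7 : y i = (y i).1 • ⟨S.vtx i.1, Ideal.mem_span_singleton_self _⟩ := by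
      obtain ⟨z, hz⟩ := Ideal.mem_span_singleton'.1 (y i).2
      refine Subtype.ext ?_
      change (y i).1 = (y i).1 * S.vtx i.1
      rw [← hz, mul_assoc, S.vtx_mul_vtx]
    rw [h7, DFinsupp.single_smul]
    exact Submodule.smul_mem_smul h6 Submodule.mem_top
  · have h1 : π (m i) = 0 := (Submodule.Quotient.mk_eq_zero _).2 h
    have h2 := hcrd_self i
    rw [h1, map_zero] at h2
    exact zero_ne_one h2

end Modules

end PathSystem

/-! ### Initial and terminal subpaths -/

section Subpaths

variable {W : Type u} [Quiver.{u} W]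

/-- `q` is a terminal subpath of `p`. -/
def IsTail (q p : TotalPath W) : Prop :=
  ∃ (a : W) (b : Quiver.Path a q.1), p = ⟨a, q.2.1, b.comp q.2.2⟩

/-- `q` is an initial subpath of `p`. -/
def IsHead (q p : TotalPath W) : Prop :=
  ∃ (c : W) (s : Quiver.Path q.2.1 c), p = ⟨q.1, c, q.2.2.comp s⟩

theorem totalPath_mk_injective {a b : W} {p q : Quiver.Path a b}
    (h : (⟨a, b, p⟩ : TotalPath W) = ⟨a, b, q⟩) : p = q :=
  eq_of_heq (Sigma.mk.inj (eq_of_heq (Sigma.mk.inj h).2)).2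

theorem cons_eq_cons_iff {a a' b b' c c' : W} {p : Quiver.Path a b} {q : Quiver.Path a' b'}
    {e : b ⟶ c} {f : b' ⟶ c'} :
    (⟨a, c, p.cons e⟩ : TotalPath W) = ⟨a', c', q.cons f⟩ ↔
      (⟨a, b, p⟩ : TotalPath W) = ⟨a', b', q⟩ ∧
        (⟨b, c, e.toPath⟩ : TotalPath W) = ⟨b', c', f.toPath⟩ := by
  constructor
  · intro h
    obtain rfl : a = a' := congrArg Sigma.fst h
    obtain rfl : c = c' := congrArg (fun p : TotalPath W => p.2.1) h
    have h := totalPath_mk_injective h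
    obtain rfl := Quiver.Path.obj_eq_of_cons_eq_cons h
    obtain rfl := eq_of_heq (Quiver.Path.hom_heq_of_cons_eq_cons h)
    obtain rfl := eq_of_heq (Quiver.Path.heq_of_cons_eq_cons h)
    exact ⟨rfl, rfl⟩
  · rintro ⟨h, h'⟩
    obtain rfl : a = a' := congrArg Sigma.fst h
    obtain rfl : b = b' := congrArg Sigma.fst h'
    obtain rfl : c = c' := congrArg (fun p : TotalPath W => p.2.1) h'
    obtain rfl := totalPath_mk_injective h
    obtain rfl := eq_of_heq (Quiver.Path.hom_heq_of_cons_eq_cons (totalPath_mk_injective h'))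
    rfl

theorem IsTail.refl (p : TotalPath W) : IsTail p p :=
  ⟨p.1, Quiver.Path.nil, by rw [Quiver.Path.nil_comp]⟩

theorem IsHead.refl (p : TotalPath W) : IsHead p p := ⟨p.2.1, Quiver.Path.nil, rfl⟩

theorem IsTail.trans {r q p : TotalPath W} (h : IsTail r q) (h' : IsTail q p) : IsTail r p := by
  obtain ⟨a, b, rfl⟩ := h
  obtain ⟨c, d, rfl⟩ := h'
  exact ⟨c, d.comp b, by rw [Quiver.Path.comp_assoc]⟩

theorem IsTail.length_le {q p : TotalPath W} (h : IsTail q p) :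
    q.2.2.length ≤ p.2.2.length := by
  obtain ⟨a, b, rfl⟩ := h
  rw [Quiver.Path.length_comp]
  exact Nat.le_add_left _ _

theorem IsHead.length_le {q p : TotalPath W} (h : IsHead q p) :
    q.2.2.length ≤ p.2.2.length := by
  obtain ⟨a, b, rfl⟩ := h
  rw [Quiver.Path.length_comp]
  exact Nat.le_add_right _ _

theorem IsTail.target_eq {q p : TotalPath W} (h : IsTail q p) : p.2.1 = q.2.1 := by
  obtain ⟨a, b, rfl⟩ := h
  rfl

theorem IsTail.eq_of_length_le {q p : TotalPath W} (h : IsTail q p)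
    (hl : p.2.2.length ≤ q.2.2.length) : q = p := by
  obtain ⟨c, d, q⟩ := q
  obtain ⟨a, b, rfl⟩ := h
  rw [Quiver.Path.length_comp] at hl
  have hb : b.length = 0 := by simpa using hl
  obtain rfl := Quiver.Path.eq_of_length_zero b hb
  obtain rfl := Quiver.Path.eq_nil_of_length_zero b hb
  rw [Quiver.Path.nil_comp]

theorem exists_isTail_length_eq (p : TotalPath W) {n : ℕ} (hn : n ≤ p.2.2.length) :
    ∃ q, IsTail q p ∧ q.2.2.length = n := by
  obtain ⟨a, b, p⟩ := p
  obtain ⟨v, p₁, p₂, rfl, hl⟩ := p.exists_eq_comp_of_le_length (Nat.sub_le p.length n)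
  refine ⟨⟨v, b, p₂⟩, ⟨a, p₁, rfl⟩, ?_⟩
  change n ≤ (p₁.comp p₂).length at hn
  rw [Quiver.Path.length_comp] at hl hn
  change p₂.length = n
  omega

theorem eq_of_comp_eq_comp {a b c d : W} (p₁ : Quiver.Path a b) (q₁ : Quiver.Path b d)
    (p₂ : Quiver.Path a c) (q₂ : Quiver.Path c d) (hl : q₁.length = q₂.length)
    (h : p₁.comp q₁ = p₂.comp q₂) :
    (⟨b, d, q₁⟩ : TotalPath W) = ⟨c, d, q₂⟩ := by
  induction q₁ with
  | nil =>
    obtain rfl := Quiver.Path.eq_of_length_zero q₂ hl.symm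
    obtain rfl := Quiver.Path.eq_nil_of_length_zero q₂ hl.symm
    rfl
  | cons q₁ e ih =>
    cases q₂ with
    | nil => exact absurd hl (Nat.succ_ne_zero _)
    | cons q₂ f =>
      rw [Quiver.Path.comp_cons, Quiver.Path.comp_cons] at h
      obtain rfl := Quiver.Path.obj_eq_of_cons_eq_cons h
      obtain rfl := eq_of_heq (Quiver.Path.hom_heq_of_cons_eq_cons h)
      have := ih q₂ (Nat.succ_injective hl) (eq_of_heq (Quiver.Path.heq_of_cons_eq_cons h))
      cases this
      rfl

theorem IsTail.eq_of_length_eq {q₁ q₂ p : TotalPath W} (h₁ : IsTail q₁ p) (h₂ : IsTail q₂ p)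
    (hl : q₁.2.2.length = q₂.2.2.length) : q₁ = q₂ := by
  obtain ⟨a, b, q₁⟩ := q₁
  obtain ⟨c, d, q₂⟩ := q₂
  obtain ⟨e, p₁, rfl⟩ := h₁
  obtain ⟨e', p₂, h⟩ := h₂
  obtain rfl : e = e' := congrArg Sigma.fst h
  obtain rfl : b = d := congrArg (fun p : TotalPath W => p.2.1) h
  exact eq_of_comp_eq_comp p₁ q₁ p₂ q₂ hl (totalPath_mk_injective h)

/-- Terminal subpaths of one path are determined by their length, so any two are comparable. -/
theorem IsTail.of_length_le {q₁ q₂ p : TotalPath W} (h₁ : IsTail q₁ p) (h₂ : IsTail q₂ p)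
    (hl : q₁.2.2.length ≤ q₂.2.2.length) : IsTail q₁ q₂ := by
  obtain ⟨q, hq, hql⟩ := exists_isTail_length_eq q₂ hl
  rwa [h₁.eq_of_length_eq (hq.trans h₂) hql.symm]

theorem isTail_cons_cons {a b c d : W} {q : Quiver.Path a c} {p : Quiver.Path b c} {e : c ⟶ d} :
    IsTail (⟨a, d, q.cons e⟩ : TotalPath W) ⟨b, d, p.cons e⟩ ↔
      IsTail (⟨a, c, q⟩ : TotalPath W) ⟨b, c, p⟩ := by
  constructor
  · rintro ⟨x, s, h⟩
    exact ⟨x, s, (cons_eq_cons_iff.1 h).1⟩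
  · rintro ⟨x, s, h⟩
    exact ⟨x, s, cons_eq_cons_iff.2 ⟨h, rfl⟩⟩

theorem isHead_cons {q : TotalPath W} {a b c : W} {p : Quiver.Path a b} {e : b ⟶ c} :
    IsHead q ⟨a, c, p.cons e⟩ ↔ IsHead q ⟨a, b, p⟩ ∨ q = ⟨a, c, p.cons e⟩ := by
  constructor
  · rintro ⟨d, s, h⟩
    obtain ⟨x, y, q⟩ := q
    cases s with
    | nil =>
      right
      exact h.symm
    | cons s f =>
      left
      exact ⟨_, s, (cons_eq_cons_iff.1 h).1⟩
  · rintro (⟨d, s, h⟩ | rfl)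
    · obtain ⟨x, y, q⟩ := q
      obtain rfl : a = x := congrArg Sigma.fst h
      obtain rfl : b = d := congrArg (fun p : TotalPath W => p.2.1) h
      obtain rfl := totalPath_mk_injective h
      exact ⟨c, s.cons e, rfl⟩
    · exact IsHead.refl _

end Subpaths

/-! ### Monomial algebras -/

/-- A description of the `K`-algebra `R` as a finite dimensional monomial quotient of the path
algebra of `W`: the nonzero paths form a basis. -/
structure PathBasis (K W R : Type u) [Field K] [Quiver.{u} W] [Fintype W] [Ring R]
    [Algebra K R] extends PathSystem K W R where
  coef : R →ₗ[K] (TotalPath W →₀ K)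
  coef_path : ∀ p, path p ≠ 0 → coef (path p) = Finsupp.single p 1
  finite_path_ne_zero : {p | path p ≠ 0}.Finite

namespace PathBasis

variable {K W R : Type u} [Field K] [Quiver.{u} W] [Fintype W] [Ring R] [Algebra K R]
  (S : PathBasis K W R)

theorem path_ne_zero_of_isTail {q p : TotalPath W} (h : IsTail q p) (hp : S.path p ≠ 0) :
    S.path q ≠ 0 := by
  obtain ⟨a, b, rfl⟩ := h
  rw [← S.path_mul_path] at hp
  exact left_ne_zero_of_mul hp

theorem path_mul_path_cases (p q : TotalPath W) :
    S.path p * S.path q = 0 ∨ ∃ r, IsTail p r ∧ S.path p * S.path q = S.path r := by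
  by_cases h : p.1 = q.2.1
  · obtain ⟨a, b, p⟩ := p
    obtain ⟨c, d, q⟩ := q
    obtain rfl : a = d := h
    exact Or.inr ⟨_, ⟨c, q, rfl⟩, S.path_mul_path p q⟩
  · exact Or.inl (S.path_mul_path_of_ne h)

theorem coef_path_apply_ne {p q : TotalPath W} (h : p ≠ q) : S.coef (S.path p) q = 0 := by
  by_cases hp : S.path p = 0
  · rw [hp, map_zero, Finsupp.zero_apply]
  · rw [S.coef_path p hp, Finsupp.single_eq_of_ne h.symm]

theorem coef_path_apply_self {p : TotalPath W} (h : S.path p ≠ 0) :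
    S.coef (S.path p) p = 1 := by
  rw [S.coef_path p h, Finsupp.single_eq_same]

theorem linearCombination_coef (x : R) :
    Finsupp.linearCombination K S.path (S.coef x) = x := by
  refine LinearMap.congr_fun (f := Finsupp.linearCombination K S.path ∘ₗ S.coef)
    (g := LinearMap.id) (S.hom_ext fun p => ?_) x
  rw [LinearMap.comp_apply, LinearMap.id_apply]
  by_cases hp : S.path p = 0
  · rw [hp, map_zero, map_zero]
  · rw [S.coef_path p hp, Finsupp.linearCombination_single, one_smul]

theorem coef_injective {x y : R} (h : S.coef x = S.coef y) : x = y := by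
  rw [← S.linearCombination_coef x, h, S.linearCombination_coef]

theorem coef_eq_zero_of_path_eq_zero {p : TotalPath W} (hp : S.path p = 0) (x : R) :
    S.coef x p = 0 := by
  refine LinearMap.congr_fun (f := Finsupp.lapply p ∘ₗ S.coef) (g := 0)
    (S.hom_ext fun q => ?_) x
  by_cases hq : q = p
  · rw [hq, hp, map_zero, map_zero]
  · exact S.coef_path_apply_ne hq

/-- Right multiplication prolongs `p` at its start only, which leaves `p` a terminal subpath. All
cutting arguments rest on this. -/
theorem isTail_of_coef_ne_zero {p r : TotalPath W} {x : R} (h : S.coef (S.path p * x) r ≠ 0) :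
    IsTail p r := by
  by_contra hpr
  refine h ?_
  refine LinearMap.congr_fun
    (f := Finsupp.lapply r ∘ₗ S.coef ∘ₗ LinearMap.mulLeft K (S.path p)) (g := 0)
    (S.hom_ext fun q => ?_) x
  change S.coef (S.path p * S.path q) r = 0
  obtain h | ⟨t, ht, h⟩ := S.path_mul_path_cases p q
  · rw [h, map_zero, Finsupp.zero_apply]
  · rw [h]
    refine S.coef_path_apply_ne ?_
    rintro rfl
    exact hpr ht

/-- In a monomial algebra an arrow acts injectively on the paths that it does not kill, so it merely
relocates coefficients. -/
theorem coef_arrow_mul {a b c : W} (q : Quiver.Path a b) (α : b ⟶ c)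
    (h : S.path ⟨a, c, q.cons α⟩ ≠ 0) (x : R) :
    S.coef (S.path ⟨b, c, α.toPath⟩ * x) ⟨a, c, q.cons α⟩ = S.coef x ⟨a, b, q⟩ := by
  refine LinearMap.congr_fun
    (f := Finsupp.lapply (⟨a, c, q.cons α⟩ : TotalPath W) ∘ₗ S.coef ∘ₗ
      LinearMap.mulLeft K (S.path ⟨b, c, α.toPath⟩))
    (g := Finsupp.lapply (⟨a, b, q⟩ : TotalPath W) ∘ₗ S.coef) (S.hom_ext fun t => ?_) x
  change S.coef (S.path ⟨b, c, α.toPath⟩ * S.path t) _ = S.coef (S.path t) _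
  obtain ⟨d, e, t⟩ := t
  by_cases hbe : b = e
  · subst hbe
    rw [← S.path_cons]
    by_cases ht : (⟨d, b, t⟩ : TotalPath W) = ⟨a, b, q⟩
    · cases ht
      rw [S.coef_path_apply_self h, S.coef_path_apply_self]
      intro h0
      rw [S.path_cons, h0, mul_zero] at h
      exact h rfl
    · rw [S.coef_path_apply_ne ht, S.coef_path_apply_ne fun h => ht (cons_eq_cons_iff.1 h).1]
  · rw [S.path_mul_path_of_ne (by exact hbe), map_zero, Finsupp.zero_apply,
      S.coef_path_apply_ne]
    intro h
    exact hbe (congrArg (fun p : TotalPath W => p.2.1) h).symm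

open Classical in
/-- The projection of `R` onto the span of the paths with a given property. -/
noncomputable def proj (A : TotalPath W → Prop) : R →ₗ[K] R :=
  Finsupp.linearCombination K (fun p => if A p then S.path p else 0) ∘ₗ S.coef

theorem proj_path {A : TotalPath W → Prop} {p : TotalPath W} (h : A p) :
    S.proj A (S.path p) = S.path p := by
  by_cases hp : S.path p = 0
  · rw [hp, map_zero]
  · rw [proj, LinearMap.comp_apply, S.coef_path p hp, Finsupp.linearCombination_single, one_smul,
      if_pos h]

theorem proj_path_of_not {A : TotalPath W → Prop} {p : TotalPath W} (h : ¬ A p) :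
    S.proj A (S.path p) = 0 := by
  by_cases hp : S.path p = 0
  · rw [hp, map_zero]
  · rw [proj, LinearMap.comp_apply, S.coef_path p hp, Finsupp.linearCombination_single, one_smul,
      if_neg h]

theorem coef_proj {A : TotalPath W → Prop} {p : TotalPath W} (h : A p) (x : R) :
    S.coef (S.proj A x) p = S.coef x p := by
  refine LinearMap.congr_fun (f := Finsupp.lapply p ∘ₗ S.coef ∘ₗ S.proj A)
    (g := Finsupp.lapply p ∘ₗ S.coef) (S.hom_ext fun q => ?_) x
  change S.coef (S.proj A (S.path q)) p = S.coef (S.path q) p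
  by_cases hq : A q
  · rw [S.proj_path hq]
  · rw [S.proj_path_of_not hq, S.coef_path_apply_ne, map_zero, Finsupp.zero_apply]
    rintro rfl
    exact hq h

theorem coef_proj_of_not {A : TotalPath W → Prop} {p : TotalPath W} (h : ¬ A p) (x : R) :
    S.coef (S.proj A x) p = 0 := by
  refine LinearMap.congr_fun (f := Finsupp.lapply p ∘ₗ S.coef ∘ₗ S.proj A)
    (g := 0) (S.hom_ext fun q => ?_) x
  change S.coef (S.proj A (S.path q)) p = 0
  by_cases hq : A q
  · rw [S.proj_path hq, S.coef_path_apply_ne]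
    rintro rfl
    exact h hq
  · rw [S.proj_path_of_not hq, map_zero, Finsupp.zero_apply]

/-- Left multiples of paths of positive length are `K`-combinations of such paths, so radical
elements can be treated path by path. -/
theorem mem_span_of_mem_rad {x : R} (hx : x ∈ S.rad) :
    x ∈ Submodule.span K {x | ∃ q : TotalPath W, 0 < q.2.2.length ∧ S.path q = x} := by
  let T : Submodule K R := Submodule.span K {x | ∃ q : TotalPath W, 0 < q.2.2.length ∧ S.path q = x}
  have hT (r x : R) (hx : x ∈ T) : r * x ∈ T := by
    induction hx using Submodule.span_induction with
    | mem x h =>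
      obtain ⟨q, hq, rfl⟩ := h
      induction r using S.induction_on with
      | path t =>
        by_cases h : t.1 = q.2.1
        · obtain ⟨a, b, t⟩ := t
          obtain ⟨c, d, q⟩ := q
          obtain rfl : a = d := h
          rw [S.path_mul_path]
          refine Submodule.subset_span ⟨_, ?_, rfl⟩
          rw [Quiver.Path.length_comp]
          exact Nat.add_pos_left hq _
        · rw [S.path_mul_path_of_ne h]
          exact zero_mem _
      | zero => rw [zero_mul]; exact zero_mem _
      | add x y hx hy => rw [add_mul]; exact add_mem hx hy
      | smul c x hx => rw [smul_mul_assoc]; exact T.smul_mem c hx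
    | zero => rw [mul_zero]; exact zero_mem _
    | add x y _ _ hx hy => rw [mul_add]; exact add_mem hx hy
    | smul c x _ hx => rw [mul_smul_comm]; exact T.smul_mem c hx
  induction hx using Submodule.span_induction with
  | mem x h => exact Submodule.subset_span h
  | zero => exact zero_mem _
  | add x y _ _ hx hy => exact add_mem hx hy
  | smul r x _ hx => exact hT r x hx

/-! ### Coefficients of elements of free modules -/

section Free

variable {ι : Type u}

theorem free_hom_ext {M : Type*} [AddCommGroup M] [Module K M] {f g : (ι →₀ R) →ₗ[K] M}
    (h : ∀ s p, f (Finsupp.single s (S.path p)) = g (Finsupp.single s (S.path p))) : f = g :=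
  Finsupp.lhom_ext' fun s => S.hom_ext fun p => h s p

theorem free_ext {x y : ι →₀ R} (h : ∀ s p, S.coef (x s) p = S.coef (y s) p) : x = y :=
  Finsupp.ext fun s => S.coef_injective (Finsupp.ext (h s))

/-- The projection of a free module onto the span of the paths with a given property. -/
noncomputable def projF (A : TotalPath W → Prop) : (ι →₀ R) →ₗ[K] (ι →₀ R) :=
  Finsupp.mapRange.linearMap (S.proj A)

theorem projF_apply (A : TotalPath W → Prop) (x : ι →₀ R) (s : ι) :
    S.projF A x s = S.proj A (x s) := rfl

theorem projF_single (A : TotalPath W → Prop) (s : ι) (x : R) :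
    S.projF A (Finsupp.single s x) = Finsupp.single s (S.proj A x) :=
  Finsupp.mapRange_single (hf := map_zero _)

theorem projF_eq_self_iff {A : TotalPath W → Prop} {x : ι →₀ R} :
    S.projF A x = x ↔ ∀ s p, S.coef (x s) p ≠ 0 → A p := by
  constructor
  · intro h s p hp
    by_contra hA
    rw [← h, projF_apply, S.coef_proj_of_not hA] at hp
    exact hp rfl
  · intro h
    refine S.free_ext fun s p => ?_
    rw [projF_apply]
    by_cases hA : A p
    · rw [S.coef_proj hA]
    · rw [S.coef_proj_of_not hA]
      by_contra h0
      exact hA (h s p (Ne.symm h0))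

theorem proj_path_mul {B : TotalPath W → Prop} {q : TotalPath W} (h : ∀ r, IsTail q r → B r)
    (x : R) : S.proj B (S.path q * x) = S.path q * x := by
  refine S.coef_injective (Finsupp.ext fun r => ?_)
  by_cases hr : B r
  · rw [S.coef_proj hr]
  · rw [S.coef_proj_of_not hr]
    by_contra h0
    exact hr (h r (S.isTail_of_coef_ne_zero (Ne.symm h0)))

theorem proj_path_mul_of_not {B : TotalPath W → Prop} {q : TotalPath W}
    (h : ∀ r, IsTail q r → ¬ B r) (x : R) : S.proj B (S.path q * x) = 0 := by
  refine S.coef_injective (Finsupp.ext fun r => ?_)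
  rw [map_zero, Finsupp.zero_apply]
  by_cases hr : B r
  · rw [S.coef_proj hr]
    by_contra h0
    exact h r (S.isTail_of_coef_ne_zero h0) hr
  · rw [S.coef_proj_of_not hr]

theorem map_single_path (f : (ι →₀ R) →ₗ[R] R) (s : ι) (q : TotalPath W) :
    f (Finsupp.single s (S.path q)) = S.path q * f (Finsupp.single s 1) := by
  rw [← smul_eq_mul, ← map_smul, Finsupp.smul_single, smul_eq_mul, mul_one]

/-- Right multiplication prolongs paths at their start, so a support condition stable under such
prolongation passes from the argument of `f` to its value. -/
theorem proj_map_projF {A B : TotalPath W → Prop} (h : ∀ q r, A q → IsTail q r → B r)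
    (f : (ι →₀ R) →ₗ[R] R) (x : ι →₀ R) : S.proj B (f (S.projF A x)) = f (S.projF A x) := by
  refine LinearMap.congr_fun
    (f := S.proj B ∘ₗ f.restrictScalars K ∘ₗ S.projF A) (g := f.restrictScalars K ∘ₗ S.projF A)
    (S.free_hom_ext fun s q => ?_) x
  change S.proj B (f (S.projF A (Finsupp.single s (S.path q)))) =
    f (S.projF A (Finsupp.single s (S.path q)))
  rw [projF_single]
  by_cases hq : A q
  · rw [S.proj_path hq, S.map_single_path, S.proj_path_mul fun r hr => h q r hq hr]
  · rw [S.proj_path_of_not hq, Finsupp.single_zero, map_zero, map_zero]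

theorem proj_map_projF_of_not {A B : TotalPath W → Prop} (h : ∀ q r, A q → IsTail q r → ¬ B r)
    (f : (ι →₀ R) →ₗ[R] R) (x : ι →₀ R) : S.proj B (f (S.projF A x)) = 0 := by
  refine LinearMap.congr_fun
    (f := S.proj B ∘ₗ f.restrictScalars K ∘ₗ S.projF A) (g := 0)
    (S.free_hom_ext fun s q => ?_) x
  change S.proj B (f (S.projF A (Finsupp.single s (S.path q)))) = 0
  rw [projF_single]
  by_cases hq : A q
  · rw [S.proj_path hq, S.map_single_path, S.proj_path_mul_of_not fun r hr => h q r hq hr]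
  · rw [S.proj_path_of_not hq, Finsupp.single_zero, map_zero, map_zero]

/-- An element of a submodule with torsionless quotient, with no terms at the proper terminal
subpaths of `p`: the sum of its terms at the paths ending with `p` is in the submodule. -/
theorem projF_mem {X : Submodule R (ι →₀ R)}
    (hX : ∀ z, (∀ f : (ι →₀ R) →ₗ[R] R, (∀ x ∈ X, f x = 0) → f z = 0) → z ∈ X)
    {x : ι →₀ R} (hx : x ∈ X) (p : TotalPath W)
    (h : ∀ q, IsTail q p → q ≠ p → ∀ s, S.coef (x s) q = 0) : S.projF (IsTail p) x ∈ X := by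
  refine hX _ fun f hf => ?_
  -- With no terms at proper terminal subpaths of `p`, the element `x` splits into a part ending
  -- with `p` and a part incomparable with `p`. No path ends with two incomparable paths, so `f`
  -- sends the parts to elements with disjoint supports and kills each of them.
  have h1 : x = S.projF (IsTail p) x + S.projF (fun r => ¬ IsTail p r ∧ ¬ IsTail r p) x := by
    refine S.free_ext fun s r => ?_
    rw [Finsupp.add_apply, map_add, Finsupp.add_apply, projF_apply, projF_apply]
    by_cases hpr : IsTail p r
    · rw [S.coef_proj hpr, S.coef_proj_of_not fun h => h.1 hpr, add_zero]
    · rw [S.coef_proj_of_not hpr, zero_add]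
      by_cases hrp : IsTail r p
      · rw [S.coef_proj_of_not fun h => h.2 hrp, h r hrp]
        rintro rfl
        exact hpr hrp
      · rw [S.coef_proj ⟨hpr, hrp⟩]
  have h2 := hf x hx
  rw [h1, map_add] at h2
  have h3 := congrArg (S.proj (IsTail p)) h2
  rwa [map_add, map_zero, S.proj_map_projF (fun q r hq hr => hq.trans hr),
    S.proj_map_projF_of_not, add_zero] at h3
  intro q r hq hqr hpr
  obtain hl | hl := le_total q.2.2.length p.2.2.length
  · exact hq.2 (hqr.of_length_le hpr hl)
  · exact hq.1 (hpr.of_length_le hqr hl)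

theorem coef_nil_of_mem_rad_smul {X : Submodule R (ι →₀ R)} {x : ι →₀ R} (hx : x ∈ S.rad • X)
    (v : W) (s : ι) : S.coef (x s) ⟨v, v, Quiver.Path.nil⟩ = 0 := by
  induction hx using Submodule.smul_induction_on' with
  | smul r hr y hy =>
    rw [Finsupp.smul_apply, smul_eq_mul]
    have hr' := S.mem_span_of_mem_rad hr
    clear hr
    induction hr' using Submodule.span_induction with
    | mem x h =>
      obtain ⟨q, hq, rfl⟩ := h
      by_contra h
      exact absurd (S.isTail_of_coef_ne_zero h).length_le (by simpa using hq.ne')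
    | zero => rw [zero_mul, map_zero, Finsupp.zero_apply]
    | add x y _ _ hx hy => rw [add_mul, map_add, Finsupp.add_apply, hx, hy, add_zero]
    | smul c x _ hx => rw [smul_mul_assoc, map_smul, Finsupp.smul_apply, hx, smul_zero]
  | add x _ y _ hx hy => rw [Finsupp.add_apply, map_add, Finsupp.add_apply, hx, hy, add_zero]

/-- At the terminal subpaths of `p α`, an element of the radical of `X` looks like `α x`. -/
theorem exists_coef_eq_of_mem_rad_smul {X : Submodule R (ι →₀ R)} {a b c : W}
    (p : Quiver.Path a b) (α : b ⟶ c) {j : ι →₀ R} (hj : j ∈ S.rad • X) :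
    ∃ x ∈ X, ∀ q, IsTail q ⟨a, c, p.cons α⟩ →
      ∀ s, S.coef (j s) q = S.coef ((S.path ⟨b, c, α.toPath⟩ • x) s) q := by
  induction hj using Submodule.smul_induction_on' with
  | smul r hr y hy =>
    have hr' := S.mem_span_of_mem_rad hr
    clear hr
    induction hr' using Submodule.span_induction with
    | mem x h =>
      obtain ⟨t, ht, rfl⟩ := h
      obtain ⟨d, e, t⟩ := t
      cases t with
      | nil => exact absurd ht (lt_irrefl _)
      | @cons f _ t β =>
        by_cases hαβ : (⟨f, e, β.toPath⟩ : TotalPath W) = ⟨b, c, α.toPath⟩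
        · refine ⟨S.path ⟨d, f, t⟩ • y, X.smul_mem _ hy, fun q _ s => ?_⟩
          rw [← mul_smul, S.path_cons]
          obtain rfl : f = b := congrArg Sigma.fst hαβ
          rw [hαβ]
        · refine ⟨0, X.zero_mem, fun q hq s => ?_⟩
          rw [smul_zero, Finsupp.zero_apply, map_zero, Finsupp.zero_apply, Finsupp.smul_apply,
            smul_eq_mul]
          by_contra h
          rw [S.path_cons, mul_assoc] at h
          exact hαβ (((S.isTail_of_coef_ne_zero h).trans hq).eq_of_length_eq
            ⟨a, p, rfl⟩ rfl)
    | zero => exact ⟨0, X.zero_mem, fun q _ s => by rw [zero_smul, smul_zero]⟩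
    | add r r' _ _ hr hr' =>
      obtain ⟨x, hx, h⟩ := hr
      obtain ⟨x', hx', h'⟩ := hr'
      refine ⟨x + x', X.add_mem hx hx', fun q hq s => ?_⟩
      rw [add_smul, smul_add, Finsupp.add_apply, Finsupp.add_apply, map_add, map_add,
        Finsupp.add_apply, Finsupp.add_apply, h q hq s, h' q hq s]
    | smul k r _ hr =>
      obtain ⟨x, hx, h⟩ := hr
      refine ⟨k • x, Submodule.smul_of_tower_mem _ k hx, fun q hq s => ?_⟩
      have h1 (z : ι →₀ R) : S.coef ((k • z) s) q = k • S.coef (z s) q := by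
        rw [Finsupp.smul_apply, map_smul, Finsupp.smul_apply]
      rw [smul_assoc, smul_comm _ k x, h1, h1, h q hq s]
  | add x _ y _ hx hy =>
    obtain ⟨x', hx, h⟩ := hx
    obtain ⟨y', hy, h'⟩ := hy
    refine ⟨x' + y', X.add_mem hx hy, fun q hq s => ?_⟩
    rw [smul_add, Finsupp.add_apply, Finsupp.add_apply, map_add, map_add,
      Finsupp.add_apply, Finsupp.add_apply, h q hq s, h' q hq s]

end Free

end PathBasis

/-! ### Splitting off a left ideal generated by a path -/

namespace PathBasis

variable {K W R : Type u} [Field K] [Quiver.{u} W] [Fintype W] [Ring R] [Algebra K R]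
  (S : PathBasis K W R) {ι : Type u}

theorem projF_isTail_smul (p : TotalPath W) (x : ι →₀ R) :
    S.projF (IsTail p) (S.path p • x) = S.path p • x := by
  rw [S.projF_eq_self_iff]
  intro s r hr
  rw [Finsupp.smul_apply, smul_eq_mul] at hr
  exact S.isTail_of_coef_ne_zero hr

theorem exists_smul_eq_projF (p : TotalPath W) (x : ι →₀ R) :
    ∃ y : ι →₀ R, S.projF (IsTail p) x = S.path p • y := by
  have h1 (r : R) : ∃ r', S.proj (IsTail p) r = S.path p * r' := by
    induction r using S.induction_on with
    | path q =>
      by_cases h : IsTail p q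
      · rw [S.proj_path h]
        obtain ⟨a, b, rfl⟩ := h
        exact ⟨S.path ⟨a, p.1, b⟩, (S.path_mul_path _ _).symm⟩
      · exact ⟨0, by rw [S.proj_path_of_not h, mul_zero]⟩
    | zero => exact ⟨0, by rw [map_zero, mul_zero]⟩
    | add x y hx hy =>
      obtain ⟨x', hx⟩ := hx
      obtain ⟨y', hy⟩ := hy
      exact ⟨x' + y', by rw [map_add, mul_add, hx, hy]⟩
    | smul c x hx =>
      obtain ⟨x', hx⟩ := hx
      exact ⟨c • x', by rw [map_smul, mul_smul_comm, hx]⟩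
  induction x using Finsupp.induction_linear with
  | zero => exact ⟨0, by rw [map_zero, smul_zero]⟩
  | add x y hx hy =>
    obtain ⟨x', hx⟩ := hx
    obtain ⟨y', hy⟩ := hy
    exact ⟨x' + y', by rw [map_add, smul_add, hx, hy]⟩
  | single s r =>
    obtain ⟨r', hr⟩ := h1 r
    exact ⟨Finsupp.single s r', by rw [projF_single, hr, Finsupp.smul_single, smul_eq_mul]⟩

theorem eq_zero_of_projF_eq_self {p : TotalPath W} (hp : S.path p = 0) {x : ι →₀ R}
    (hx : S.projF (IsTail p) x = x) : x = 0 := by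
  obtain ⟨y, hy⟩ := S.exists_smul_eq_projF p x
  rw [← hx, hy, hp, zero_smul]

/-! ### Leading coefficients that cannot be lifted -/

section Top

variable {X : Submodule R (ι →₀ R)}

open Classical in
/-- An element supported on paths that properly extend `p` is the sum of its parts supported on the
paths which extend the one-arrow extensions of `p`. -/
theorem sum_projF_eq (p : TotalPath W) {y : ι →₀ R} (hy : S.projF (IsTail p) y = y)
    (hyp : ∀ s, S.coef (y s) p = 0) :
    ∑ q ∈ S.finite_path_ne_zero.toFinset with
      (IsTail p q ∧ q.2.2.length = p.2.2.length + 1), S.projF (IsTail q) y = y := by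
  refine S.free_ext fun s r => ?_
  rw [Finsupp.finsetSum_apply, map_sum, Finsupp.finsetSum_apply]
  by_cases h0 : S.coef (y s) r = 0
  · rw [h0]
    refine Finset.sum_eq_zero fun q _ => ?_
    rw [projF_apply]
    by_cases hq : IsTail q r
    · rw [S.coef_proj hq, h0]
    · rw [S.coef_proj_of_not hq]
  have hpr : IsTail p r := S.projF_eq_self_iff.1 hy s r h0
  have hr : S.path r ≠ 0 := fun h => h0 (S.coef_eq_zero_of_path_eq_zero h _)
  have hl : p.2.2.length + 1 ≤ r.2.2.length := by
    by_contra hl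
    obtain rfl := hpr.eq_of_length_le (by omega)
    exact h0 (hyp s)
  obtain ⟨q, hqr, hql⟩ := exists_isTail_length_eq r hl
  rw [Finset.sum_eq_single q, projF_apply, S.coef_proj hqr]
  · intro t ht htq
    rw [projF_apply, S.coef_proj_of_not]
    intro htr
    exact htq (htr.eq_of_length_eq hqr ((Finset.mem_filter.1 ht).2.2.trans hql.symm))
  · intro h
    refine absurd (Finset.mem_filter.2 ⟨?_, hpr.of_length_le hqr (by omega), hql⟩) h
    exact S.finite_path_ne_zero.mem_toFinset.2 (S.path_ne_zero_of_isTail hqr hr)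

/-- Otherwise every element of `X` supported on paths ending with a path `p` to `v` lies in `rad X`,
by induction from long paths, which vanish, to short ones: subtracting some `α x'` removes the
leading coefficients, and the rest is cut along the one-arrow extensions of `p`. The trivial path at
`v` yields `x ∈ rad X`. -/
theorem exists_lift_free
    (hX : ∀ z, (∀ f : (ι →₀ R) →ₗ[R] R, (∀ x ∈ X, f x = 0) → f z = 0) → z ∈ X)
    (hXr : X ≤ S.rad • ⊤) {v : W} {x : ι →₀ R} (hx : x ∈ X) (hv : S.vtx v • x = x)
    (hxr : x ∉ S.rad • X) :
    ∃ (a b : W) (p : Quiver.Path a b) (α : b ⟶ v), S.path ⟨a, v, p.cons α⟩ ≠ 0 ∧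
      ∃ g ∈ X, S.projF (IsTail ⟨a, v, p.cons α⟩) g = g ∧
        ∀ x ∈ X, S.projF (IsTail ⟨a, b, p⟩) x = x →
          ∃ s, S.coef (g s) ⟨a, v, p.cons α⟩ ≠ S.coef (x s) ⟨a, b, p⟩ := by
  by_contra! hcon
  obtain ⟨m, hm⟩ := S.exists_path_eq_zero
  have key (k : ℕ) (p : TotalPath W) (hpv : p.2.1 = v) (hk : m ≤ p.2.2.length + k) (x : ι →₀ R)
      (hx : x ∈ X) (hpx : S.projF (IsTail p) x = x) : x ∈ S.rad • X := by
    induction k generalizing p x with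
    | zero =>
      rw [S.eq_zero_of_projF_eq_self (hm p hk) hpx]
      exact zero_mem _
    | succ k ih =>
      have h1 (y : ι →₀ R) (hy : y ∈ X) (hpy : S.projF (IsTail p) y = y)
          (hyp : ∀ s, S.coef (y s) p = 0) : y ∈ S.rad • X := by
        classical
        rw [← S.sum_projF_eq p hpy hyp]
        refine sum_mem fun q hq => ?_
        obtain ⟨-, hpq, hql⟩ := Finset.mem_filter.1 hq
        refine ih q (hpq.target_eq.trans hpv) (by omega) _ (S.projF_mem hX hy q ?_) ?_
        · intro t ht htq s
          by_contra h0
          have hpt : IsTail p t := S.projF_eq_self_iff.1 hpy s t h0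
          have htl : t.2.2.length < q.2.2.length := by
            by_contra hl
            exact htq (ht.eq_of_length_le (not_lt.1 hl))
          obtain rfl := hpt.eq_of_length_le (by omega)
          exact h0 (hyp s)
        · rw [S.projF_eq_self_iff]
          intro s t ht
          by_contra h0
          rw [projF_apply, S.coef_proj_of_not h0] at ht
          exact ht rfl
      obtain ⟨a, c, p⟩ := p
      obtain rfl : c = v := hpv
      cases p with
      -- There is no arrow to strip from the trivial path, but its coefficient is zero because `X`
      -- lies in the radical.
      | nil => exact h1 x hx hpx fun s => S.coef_nil_of_mem_rad_smul (hXr hx) a s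
      | @cons b _ p α =>
        by_cases hp : S.path ⟨a, c, p.cons α⟩ = 0
        · rw [S.eq_zero_of_projF_eq_self hp hpx]
          exact zero_mem _
        · obtain ⟨x', hx', hpx', hc⟩ := hcon a b p α hp x hx hpx
          have h2 : S.path ⟨b, c, α.toPath⟩ • x' ∈ S.rad • X :=
            Submodule.smul_mem_smul (S.path_mem_rad Nat.one_pos) hx'
          rw [← sub_add_cancel x (S.path ⟨b, c, α.toPath⟩ • x')]
          refine add_mem (h1 _ (X.sub_mem hx (X.smul_mem _ hx')) ?_ ?_) h2
          · obtain ⟨y, hy⟩ := S.exists_smul_eq_projF ⟨a, b, p⟩ x'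
            rw [map_sub, hpx, ← hpx', hy, smul_smul, ← S.path_cons, S.projF_isTail_smul]
          · intro s
            rw [Finsupp.sub_apply, map_sub, Finsupp.sub_apply, hc, Finsupp.smul_apply, smul_eq_mul,
              S.coef_arrow_mul p α hp, sub_self]
  refine hxr (key m ⟨v, v, Quiver.Path.nil⟩ rfl (Nat.le_add_left _ _) x hx ?_)
  rw [← hv]
  exact S.projF_isTail_smul _ x

/-- A radical element with the same truncation agrees, on terminal subpaths of `p` followed by `α`,
with some `α x`. Comparing coefficients, the part of `x` ending with `p` lies in `X` and lifts the
leading coefficients of `g`, against `hcon`. -/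
theorem projF_notMem
    (hX : ∀ z, (∀ f : (ι →₀ R) →ₗ[R] R, (∀ x ∈ X, f x = 0) → f z = 0) → z ∈ X)
    {a b c : W} {p : Quiver.Path a b} {α : b ⟶ c} (hp : S.path ⟨a, c, p.cons α⟩ ≠ 0)
    {g : ι →₀ R} (hg : S.projF (IsTail ⟨a, c, p.cons α⟩) g = g)
    (hcon : ∀ x ∈ X, S.projF (IsTail ⟨a, b, p⟩) x = x →
      ∃ s, S.coef (g s) ⟨a, c, p.cons α⟩ ≠ S.coef (x s) ⟨a, b, p⟩) :
    S.projF (IsTail · ⟨a, c, p.cons α⟩) g ∉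
      ((S.rad • X).restrictScalars K).map (S.projF (IsTail · ⟨a, c, p.cons α⟩)) := by
  rintro ⟨j, hj, hjg⟩
  obtain ⟨x, hx, hxj⟩ := S.exists_coef_eq_of_mem_rad_smul p α hj
  have h1 {d : W} (q : Quiver.Path d b) (hq : IsTail ⟨d, b, q⟩ ⟨a, b, p⟩) (s : ι) :
      S.coef (x s) ⟨d, b, q⟩ = S.coef (g s) ⟨d, c, q.cons α⟩ := by
    have hq' : IsTail ⟨d, c, q.cons α⟩ ⟨a, c, p.cons α⟩ := isTail_cons_cons.2 hq
    have h2 := hxj _ hq' s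
    rw [Finsupp.smul_apply, smul_eq_mul,
      S.coef_arrow_mul q α (S.path_ne_zero_of_isTail hq' hp)] at h2
    have h3 := congrArg (fun y : ι →₀ R => S.coef (y s) ⟨d, c, q.cons α⟩) hjg
    simp only [projF_apply] at h3
    rw [S.coef_proj (A := (IsTail · ⟨a, c, p.cons α⟩)) hq',
      S.coef_proj (A := (IsTail · ⟨a, c, p.cons α⟩)) hq'] at h3
    rw [← h2, h3]
  have hmem : S.projF (IsTail ⟨a, b, p⟩) x ∈ X := by
    refine S.projF_mem hX hx _ ?_
    rintro ⟨d, b', q⟩ hq hqp s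
    obtain rfl : b = b' := hq.target_eq
    rw [h1 q hq]
    by_contra h0
    have h2 := S.projF_eq_self_iff.1 hg s _ h0
    exact hqp (hq.eq_of_length_le (isTail_cons_cons.1 h2).length_le)
  have hself : S.projF (IsTail ⟨a, b, p⟩) (S.projF (IsTail ⟨a, b, p⟩) x) =
      S.projF (IsTail ⟨a, b, p⟩) x := by
    rw [S.projF_eq_self_iff]
    intro s t ht
    by_contra h0
    rw [projF_apply, S.coef_proj_of_not h0] at ht
    exact ht rfl
  obtain ⟨s, hs⟩ := hcon _ hmem hself
  refine hs ?_
  rw [projF_apply, S.coef_proj (IsTail.refl _), h1 p (IsTail.refl _)]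

end Top

/-! ### A retraction onto the left ideal of a path -/

section Retraction

variable (p : TotalPath W)

open Classical in
/-- The path `b` such that `p` is `b` followed by `q`. -/
noncomputable def cotail (q : TotalPath W) : R :=
  if h : IsTail q p then S.path ⟨h.choose, q.1, h.choose_spec.choose⟩ else 0

variable {p}

theorem path_mul_cotail {q : TotalPath W} (h : IsTail q p) :
    S.path q * S.cotail p q = S.path p := by
  rw [cotail, dif_pos h, S.path_mul_path]
  exact congrArg S.path h.choose_spec.choose_spec.symm

variable (p) (θ : (ι →₀ R) →ₗ[K] K)

open Classical in
/-- The map with values in `R p` that sends a path `t = s q` with a terminal subpath `q` of `p` to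
the multiple `θ(q) s p` of `s p`. -/
noncomputable def tailMap : (ι →₀ R) →ₗ[K] R :=
  Finsupp.lsum K fun s => ∑ q ∈ S.finite_path_ne_zero.toFinset with IsTail q p,
    θ (Finsupp.single s (S.path q)) • (LinearMap.mulRight K (S.cotail p q) ∘ₗ S.proj (IsHead q))

open Classical in
theorem tailMap_single (s : ι) (x : R) :
    S.tailMap p θ (Finsupp.single s x) =
      ∑ q ∈ S.finite_path_ne_zero.toFinset with IsTail q p,
        θ (Finsupp.single s (S.path q)) • (S.proj (IsHead q) x * S.cotail p q) := by
  rw [tailMap, Finsupp.lsum_single, LinearMap.sum_apply]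
  rfl

theorem tailMap_vtx_smul (v : W) (x : ι →₀ R) :
    S.tailMap p θ (S.vtx v • x) = S.vtx v * S.tailMap p θ x := by
  refine LinearMap.congr_fun (f := S.tailMap p θ ∘ₗ Algebra.lsmul K K (ι →₀ R) (S.vtx v))
    (g := LinearMap.mulLeft K (S.vtx v) ∘ₗ S.tailMap p θ) (S.free_hom_ext fun s t => ?_) x
  change S.tailMap p θ (S.vtx v • Finsupp.single s (S.path t)) =
    S.vtx v * S.tailMap p θ (Finsupp.single s (S.path t))
  rw [Finsupp.smul_single, smul_eq_mul, tailMap_single, tailMap_single, Finset.mul_sum]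
  refine Finset.sum_congr rfl fun q _ => ?_
  rw [mul_smul_comm, ← mul_assoc]
  congr 2
  obtain ⟨a, b, t⟩ := t
  by_cases hv : v = b
  · subst hv
    rw [S.vtx_mul_path]
    by_cases hq : IsHead q ⟨a, v, t⟩
    · rw [S.proj_path hq, S.vtx_mul_path]
    · rw [S.proj_path_of_not hq, mul_zero]
  · rw [S.vtx_mul_path_of_ne hv, map_zero]
    by_cases hq : IsHead q ⟨a, b, t⟩
    · rw [S.proj_path hq, S.vtx_mul_path_of_ne hv]
    · rw [S.proj_path_of_not hq, mul_zero]

/-- Linearity fails in one term only: following `t` by `α` creates a single new initial subpath, the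
whole path, and it counts only if it is a terminal subpath of `p`. -/
theorem tailMap_arrow_smul {b c : W} (hp : S.path p ≠ 0) (α : b ⟶ c) (x : ι →₀ R) :
    S.tailMap p θ (S.path ⟨b, c, α.toPath⟩ • x) =
      S.path ⟨b, c, α.toPath⟩ * S.tailMap p θ x +
        θ (S.projF (IsTail · p) (S.path ⟨b, c, α.toPath⟩ • x)) • S.path p := by
  refine LinearMap.congr_fun
    (f := S.tailMap p θ ∘ₗ Algebra.lsmul K K (ι →₀ R) (S.path ⟨b, c, α.toPath⟩))
    (g := LinearMap.mulLeft K (S.path ⟨b, c, α.toPath⟩) ∘ₗ S.tailMap p θ +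
      (LinearMap.toSpanSingleton K R (S.path p)) ∘ₗ θ ∘ₗ S.projF (IsTail · p) ∘ₗ
        Algebra.lsmul K K (ι →₀ R) (S.path ⟨b, c, α.toPath⟩)) (S.free_hom_ext fun s t => ?_) x
  change S.tailMap p θ (S.path ⟨b, c, α.toPath⟩ • Finsupp.single s (S.path t)) =
    S.path ⟨b, c, α.toPath⟩ * S.tailMap p θ (Finsupp.single s (S.path t)) +
      θ (S.projF (IsTail · p) (S.path ⟨b, c, α.toPath⟩ • Finsupp.single s (S.path t))) • S.path p
  classical
  rw [Finsupp.smul_single, smul_eq_mul, projF_single, tailMap_single, tailMap_single]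
  obtain ⟨a, d, t⟩ := t
  by_cases hbd : b = d
  · subst hbd
    rw [← S.path_cons]
    have hterm (q : TotalPath W) (hq : IsTail q p) :
        S.proj (IsHead q) (S.path ⟨a, c, t.cons α⟩) * S.cotail p q =
          S.path ⟨b, c, α.toPath⟩ * (S.proj (IsHead q) (S.path ⟨a, b, t⟩) * S.cotail p q) +
            if q = ⟨a, c, t.cons α⟩ then S.path p else 0 := by
      by_cases hqt : q = ⟨a, c, t.cons α⟩
      · have h1 : ¬ IsHead q ⟨a, b, t⟩ := by
          rintro h
          have := h.length_le
          rw [hqt] at this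
          exact Nat.not_succ_le_self _ this
        rw [if_pos hqt, S.proj_path_of_not h1, zero_mul, mul_zero, zero_add, ← hqt,
          S.proj_path (IsHead.refl q), S.path_mul_cotail hq]
      · rw [if_neg hqt, add_zero]
        by_cases h1 : IsHead q ⟨a, b, t⟩
        · rw [S.proj_path h1, S.proj_path (isHead_cons.2 (Or.inl h1)), S.path_cons, mul_assoc]
        · rw [S.proj_path_of_not h1, S.proj_path_of_not, zero_mul, mul_zero]
          exact fun h => (isHead_cons.1 h).elim h1 hqt
    rw [Finset.sum_congr rfl fun q hq => by rw [hterm q (Finset.mem_filter.1 hq).2]]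
    simp only [smul_add, Finset.sum_add_distrib, smul_ite, smul_zero, Finset.sum_ite_eq']
    rw [Finset.mul_sum]
    congr 1
    · exact Finset.sum_congr rfl fun q _ => (mul_smul_comm _ _ _).symm
    · by_cases hu : IsTail ⟨a, c, t.cons α⟩ p
      · rw [S.proj_path (A := (IsTail · p)) hu, if_pos]
        exact Finset.mem_filter.2
          ⟨S.finite_path_ne_zero.mem_toFinset.2 (S.path_ne_zero_of_isTail hu hp), hu⟩
      · rw [S.proj_path_of_not (A := (IsTail · p)) hu, if_neg, Finsupp.single_zero,
          map_zero, zero_smul]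
        exact fun h => hu (Finset.mem_filter.1 h).2
  · rw [S.path_mul_path_of_ne (by exact hbd), map_zero, Finsupp.single_zero, map_zero, zero_smul,
      add_zero, Finset.mul_sum]
    refine Finset.sum_congr rfl fun q _ => ?_
    rw [map_zero, zero_mul, smul_zero, mul_smul_comm, ← mul_assoc]
    by_cases hq : IsHead q ⟨a, d, t⟩
    · rw [S.proj_path hq, S.path_mul_path_of_ne (by exact hbd), zero_mul, smul_zero]
    · rw [S.proj_path_of_not hq, mul_zero, zero_mul, smul_zero]

/-- If `t` is `q` followed by `u`, then `q` contributes a multiple of `u p`. This is in the radical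
of `R p` unless `u` is trivial, that is, unless `t = q` is itself a terminal subpath of `p`. -/
theorem tailMap_sub_mem (x : ι →₀ R) :
    S.tailMap p θ x - θ (S.projF (IsTail · p) x) • S.path p ∈
      S.rad • (Ideal.span {S.path p} : Ideal R) := by
  classical
  have hpp : S.path p ∈ (Ideal.span {S.path p} : Ideal R) := Ideal.mem_span_singleton_self _
  induction x using Finsupp.induction_linear with
  | zero =>
    rw [map_zero, map_zero, map_zero, zero_smul, sub_zero]
    exact zero_mem _
  | add x y hx hy =>
    rw [map_add, map_add, map_add, add_smul, add_sub_add_comm]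
    exact add_mem hx hy
  | single s r =>
    induction r using S.induction_on with
    | zero =>
      rw [Finsupp.single_zero, map_zero, map_zero, map_zero, zero_smul, sub_zero]
      exact zero_mem _
    | add x y hx hy =>
      rw [Finsupp.single_add, map_add, map_add, map_add, add_smul, add_sub_add_comm]
      exact add_mem hx hy
    | smul c x hx =>
      rw [← Finsupp.smul_single, map_smul, map_smul, map_smul, smul_assoc, ← smul_sub]
      exact Submodule.smul_of_tower_mem _ c hx
    | path t =>
      rw [tailMap_single, projF_single]
      have h1 : θ (Finsupp.single s (S.proj (IsTail · p) (S.path t))) • S.path p =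
          ∑ q ∈ S.finite_path_ne_zero.toFinset with IsTail q p,
            θ (Finsupp.single s (S.path q)) • if q = t then S.path p else 0 := by
        simp only [smul_ite, smul_zero, Finset.sum_ite_eq']
        split_ifs with h
        · rw [S.proj_path (A := (IsTail · p)) (Finset.mem_filter.1 h).2]
        · by_cases ht : S.path t = 0
          · rw [ht, map_zero, Finsupp.single_zero, map_zero, zero_smul]
          · rw [S.proj_path_of_not, Finsupp.single_zero, map_zero, zero_smul]
            exact fun h' => h (Finset.mem_filter.2 ⟨S.finite_path_ne_zero.mem_toFinset.2 ht, h'⟩)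
      rw [h1, ← Finset.sum_sub_distrib]
      refine sum_mem fun q hq => ?_
      rw [← smul_sub]
      refine Submodule.smul_of_tower_mem _ _ ?_
      have hqp := (Finset.mem_filter.1 hq).2
      by_cases hqt : IsHead q t
      · rw [S.proj_path hqt]
        obtain ⟨c, u, rfl⟩ := hqt
        by_cases hu : u.length = 0
        · obtain rfl := Quiver.Path.eq_of_length_zero u hu
          obtain rfl := Quiver.Path.eq_nil_of_length_zero u hu
          rw [show (⟨q.1, q.2.1, q.2.2.comp Quiver.Path.nil⟩ : TotalPath W) = q from rfl,
            if_pos rfl, S.path_mul_cotail hqp, sub_self]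
          exact zero_mem _
        · rw [if_neg, sub_zero, ← S.path_mul_path, mul_assoc, S.path_mul_cotail hqp]
          · exact Submodule.smul_mem_smul (S.path_mem_rad (Nat.pos_of_ne_zero hu)) hpp
          · intro h
            have := congrArg (fun p : TotalPath W => p.2.2.length) h
            simp only [Quiver.Path.length_comp] at this
            omega
      · rw [S.proj_path_of_not hqt, zero_mul, if_neg, sub_zero]
        · exact zero_mem _
        · rintro rfl
          exact hqt (IsHead.refl _)

/-- Every error term of `tailMap_arrow_smul` is `θ` of a truncated element of `rad X`, which `hθ`
kills; linearity follows arrow by arrow. -/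
theorem tailMap_smul {X : Submodule R (ι →₀ R)} (hp : S.path p ≠ 0)
    (hθ : ∀ j ∈ S.rad • X, θ (S.projF (IsTail · p) j) = 0) (r : R) {x : ι →₀ R} (hx : x ∈ X) :
    S.tailMap p θ (r • x) = r * S.tailMap p θ x := by
  induction r using S.induction_on with
  | zero => rw [zero_smul, map_zero, zero_mul]
  | add r r' hr hr' => rw [add_smul, map_add, add_mul, hr, hr']
  | smul c r hr => rw [smul_assoc, map_smul, hr, smul_mul_assoc]
  | path t =>
    obtain ⟨a, b, t⟩ := t
    induction t with
    | nil => exact S.tailMap_vtx_smul p θ a x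
    | cons t α ih =>
      rw [S.path_cons, mul_smul, S.tailMap_arrow_smul p θ hp, ih, mul_assoc, hθ, zero_smul,
        add_zero]
      exact Submodule.smul_mem_smul (S.path_mem_rad Nat.one_pos) (X.smul_mem _ hx)

end Retraction

/-- Let `X` be a submodule of a free module, contained in the radical and with torsionless
quotient. If `X` needs a generator at the vertex `v`, then a left ideal generated by a path that
ends in `v` is a retract of `X`. -/
theorem exists_path_retract {X : Submodule R (ι →₀ R)}
    (hX : ∀ z, (∀ f : (ι →₀ R) →ₗ[R] R, (∀ x ∈ X, f x = 0) → f z = 0) → z ∈ X)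
    (hXr : X ≤ S.rad • ⊤) {v : W} {x : ι →₀ R} (hx : x ∈ X) (hv : S.vtx v • x = x)
    (hxr : x ∉ S.rad • X) :
    ∃ (a : W) (p : Quiver.Path a v), S.path ⟨a, v, p⟩ ≠ 0 ∧ 0 < p.length ∧
      (∃ y : ι →₀ R, S.path ⟨a, v, p⟩ • y ∈ X ∧ S.path ⟨a, v, p⟩ • y ≠ 0) ∧
      ∃ (i : (Ideal.span {S.path ⟨a, v, p⟩} : Ideal R) →ₗ[R] X)
        (r : X →ₗ[R] (Ideal.span {S.path ⟨a, v, p⟩} : Ideal R)),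
        Function.Bijective (r ∘ₗ i) := by
  obtain ⟨a, b, p, α, hp, g, hg, hpg, hcon⟩ := S.exists_lift_free hX hXr hx hv hxr
  have hnot := S.projF_notMem hX hp hpg hcon
  refine ⟨a, p.cons α, hp, Nat.succ_pos _, ?_⟩
  set q : TotalPath W := ⟨a, v, p.cons α⟩ with hq
  obtain ⟨y, hy⟩ := S.exists_smul_eq_projF q g
  rw [hpg] at hy
  -- A functional that vanishes on the truncations of `rad X` but not on that of `g`; dividing by
  -- its value there gives `θ`.
  obtain ⟨θ₀, hθg, hθ⟩ := Submodule.exists_le_ker_of_notMem hnot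
  let θ : (ι →₀ R) →ₗ[K] K := (θ₀ (S.projF (IsTail · q) g))⁻¹ • θ₀
  have hθg' : θ (S.projF (IsTail · q) g) = 1 := inv_mul_cancel₀ hθg
  have hθ' (j : ι →₀ R) (hj : j ∈ S.rad • X) : θ (S.projF (IsTail · q) j) = 0 := by
    rw [LinearMap.smul_apply, show θ₀ (S.projF (IsTail · q) j) = 0 from hθ ⟨j, hj, rfl⟩, smul_zero]
  have hg0 : g ≠ 0 := by
    rintro rfl
    exact hθg (by rw [map_zero, map_zero])
  refine ⟨⟨y, hy ▸ hg, hy ▸ hg0⟩, ?_⟩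
  let D : Ideal R := Ideal.span {S.path q}
  have hqD : S.path q ∈ D := Ideal.mem_span_singleton_self _
  -- Multiplication by `y` sends the generator `q` of `D` to `g = q y`.
  let i : D →ₗ[R] X := ((LinearMap.toSpanSingleton R (ι →₀ R) y).comp D.subtype).codRestrict X
    fun z => by
      obtain ⟨w, hw⟩ := Ideal.mem_span_singleton'.1 z.2
      change z.1 • y ∈ X
      rw [← hw, mul_smul, ← hy]
      exact X.smul_mem w hg
  have hmem (x : ι →₀ R) : S.tailMap q θ x ∈ D := by
    have h1 := Submodule.smul_le_right (S.tailMap_sub_mem q θ x)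
    have h2 := D.add_mem h1 (Submodule.smul_of_tower_mem D (θ (S.projF (IsTail · q) x)) hqD)
    rwa [sub_add_cancel] at h2
  let r : X →ₗ[R] D :=
    { toFun x := ⟨S.tailMap q θ x.1, hmem x.1⟩
      map_add' x z := Subtype.ext (map_add _ _ _)
      map_smul' c x := Subtype.ext (S.tailMap_smul q θ hp hθ' c x.2) }
  refine ⟨i, r, ?_⟩
  -- `r ∘ i` fixes the generator `q` modulo `rad D`, so `N` maps `D` into its radical. Hence `N` is
  -- nilpotent and `1 + N` is invertible.
  let N : Module.End R D := r ∘ₗ i - 1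
  have hN : Submodule.map N ⊤ ≤ S.rad • ⊤ := by
    rintro _ ⟨z, -, rfl⟩
    have h1 : D.subtype (N z) ∈ Submodule.map D.subtype (S.rad • ⊤) := by
      rw [Submodule.map_smul'', Submodule.map_subtype_top]
      obtain ⟨w, hw⟩ := Ideal.mem_span_singleton'.1 z.2
      have h2 : D.subtype (N z) = w • (S.tailMap q θ g - S.path q) := by
        change S.tailMap q θ (z.1 • y) - z.1 = _
        rw [← hw, mul_smul, ← hy, S.tailMap_smul q θ hp hθ' w hg, smul_sub, smul_eq_mul,
          smul_eq_mul]
      rw [h2]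
      refine Submodule.smul_mem _ w ?_
      have h3 := S.tailMap_sub_mem q θ g
      rwa [hθg', one_smul] at h3
    obtain ⟨z', hz', h⟩ := h1
    exact D.subtype_injective h ▸ hz'
  have hpow (k : ℕ) : Submodule.map (N ^ k) ⊤ ≤ S.longIdeal k • ⊤ := by
    induction k with
    | zero =>
      rw [S.longIdeal_zero, Submodule.top_smul]
      exact le_top
    | succ k ih =>
      rw [pow_succ', Module.End.mul_eq_comp, Submodule.map_comp]
      refine (Submodule.map_mono ih).trans ?_
      rw [Submodule.map_smul'']
      exact (smul_mono_right _ hN).trans (S.longIdeal_smul_rad_smul_le k ⊤)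
  obtain ⟨m, hm⟩ := S.exists_longIdeal_eq_bot
  have hnil : IsNilpotent N := by
    refine ⟨m, LinearMap.ext fun z => ?_⟩
    have h1 := hpow m ⟨z, Submodule.mem_top, rfl⟩
    rwa [hm, Submodule.bot_smul, Submodule.mem_bot] at h1
  have hunit := hnil.isUnit_one_add
  rw [add_sub_cancel] at hunit
  exact (Module.End.isUnit_iff _).1 hunit

end PathBasis

/-! ### Sources -/

namespace PathSystem

variable {K W R : Type u} [Field K] [Quiver.{u} W] [Fintype W] [Ring R] [Algebra K R]
  (S : PathSystem K W R)

theorem vtx_mul_path_of_isSource {v : W} (hv : IsSource v) {p : TotalPath W}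
    (hp : 0 < p.2.2.length) : S.vtx v * S.path p = 0 := by
  obtain ⟨a, b, p⟩ := p
  refine S.vtx_mul_path_of_ne ?_
  rintro rfl
  cases p with
  | nil => exact absurd hp (lt_irrefl 0)
  | cons p α => exact (hv _).false α

/-- Only the trivial path ends in a source, so `v R` is spanned by `v`. -/
theorem exists_vtx_mul_eq_smul {v : W} (hv : IsSource v) (x : R) :
    ∃ c : K, S.vtx v * x = c • S.vtx v := by
  induction x using S.induction_on with
  | path p =>
    by_cases hp : 0 < p.2.2.length
    · exact ⟨0, by rw [S.vtx_mul_path_of_isSource hv hp, zero_smul]⟩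
    · obtain ⟨a, b, p⟩ := p
      cases p with
      | nil =>
        by_cases h : v = a
        · subst h
          exact ⟨1, by rw [one_smul]; exact S.vtx_mul_vtx v⟩
        · exact ⟨0, by rw [zero_smul]; exact S.vtx_mul_vtx_of_ne h⟩
      | cons p α => exact absurd (Nat.succ_pos _) hp
  | zero => exact ⟨0, by rw [mul_zero, zero_smul]⟩
  | add x y hx hy =>
    obtain ⟨c, hx⟩ := hx
    obtain ⟨d, hy⟩ := hy
    exact ⟨c + d, by rw [mul_add, hx, hy, add_smul]⟩
  | smul d x hx =>
    obtain ⟨c, hx⟩ := hx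
    exact ⟨d * c, by rw [mul_smul_comm, hx, mul_smul]⟩

theorem vtx_mul_of_isSource {v : W} (hv : IsSource v) {x : R} (hx : x ∈ S.rad) :
    S.vtx v * x = 0 := by
  induction hx using Submodule.span_induction with
  | mem x h =>
    obtain ⟨p, hp, rfl⟩ := h
    exact S.vtx_mul_path_of_isSource hv hp
  | zero => rw [mul_zero]
  | add x y _ _ hx hy => rw [mul_add, hx, hy, add_zero]
  | smul y x _ hx =>
    obtain ⟨c, hc⟩ := S.exists_vtx_mul_eq_smul hv y
    rw [smul_eq_mul, ← mul_assoc, hc, smul_mul_assoc, hx, smul_zero]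

theorem vtx_smul_of_isSource {M : Type u} [AddCommGroup M] [Module R M] {v : W}
    (hv : IsSource v) {x : M} (hx : x ∈ S.rad • (⊤ : Submodule R M)) : S.vtx v • x = 0 := by
  induction hx using Submodule.smul_induction_on' with
  | smul r hr m _ => rw [smul_smul, S.vtx_mul_of_isSource hv hr, zero_smul]
  | add x _ y _ hx hy => rw [smul_add, hx, hy, add_zero]

end PathSystem

/-! ### Second syzygies over a monomial algebra -/

namespace PathBasis

variable {K W R : Type u} [Field K] [Quiver.{u} W] [Fintype W] [Ring R] [Algebra K R]
  (S : PathBasis K W R)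

variable {P Q : Type u} [AddCommGroup P] [Module R P] [Module.Projective R P]
  [AddCommGroup Q] [Module R Q] [Module.Projective R Q] {φ : P →ₗ[R] Q}

/-- The top of a second syzygy is controlled by the paths that generate a retract of it. -/
theorem exists_path_of_notMem_rad_smul (hker : LinearMap.ker φ ≤ S.rad • ⊤)
    (hφ : ∀ x, φ x ∈ S.rad • (⊤ : Submodule R Q)) {v : W} {m : LinearMap.ker φ}
    (hv : S.vtx v • m = m) (hm : m ∉ S.rad • (⊤ : Submodule R (LinearMap.ker φ))) :
    ∃ (a : W) (p : Quiver.Path a v), S.path ⟨a, v, p⟩ ≠ 0 ∧ 0 < p.length ∧ ¬ IsSource a ∧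
      ∀ n, PdLT R (LinearMap.ker φ) n → PdLT R (Ideal.span {S.path ⟨a, v, p⟩} : Ideal R) n := by
  obtain ⟨i, hi⟩ := Module.projective_def'.1 (inferInstance : Module.Projective R P)
  obtain ⟨j, hj⟩ := Module.projective_def'.1 (inferInstance : Module.Projective R Q)
  set s : (P →₀ R) →ₗ[R] P := Finsupp.linearCombination R id
  have hsi (x : P) : s (i x) = x := LinearMap.congr_fun hi x
  have hinj : Function.Injective i := Function.LeftInverse.injective hsi
  have hjinj : Function.Injective j := fun x y h => by
    rw [← LinearMap.id_apply (R := R) x, ← LinearMap.id_apply (R := R) y, ← hj,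
      LinearMap.comp_apply, h, LinearMap.comp_apply]
  let X : Submodule R (P →₀ R) := (LinearMap.ker φ).map i
  -- The coordinates of `i ∘ s - id` and of `j ∘ φ ∘ s` vanish on `X`; an element `z` killed by both
  -- families is `i (s z)` with `s z` in the kernel of `φ`.
  have hX (z : P →₀ R) (hz : ∀ f : (P →₀ R) →ₗ[R] R, (∀ x ∈ X, f x = 0) → f z = 0) :
      z ∈ X := by
    have h1 : i (s z) = z := by
      refine Finsupp.ext fun c => sub_eq_zero.1 ?_
      refine hz (Finsupp.lapply c ∘ₗ (i ∘ₗ s - LinearMap.id)) ?_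
      rintro _ ⟨x, -, rfl⟩
      change (i (s (i x)) - i x) c = 0
      rw [hsi, sub_self, Finsupp.zero_apply]
    refine ⟨s z, ?_, h1⟩
    refine hjinj (Finsupp.ext fun c => ?_)
    rw [map_zero, Finsupp.zero_apply]
    refine hz (Finsupp.lapply c ∘ₗ j ∘ₗ φ ∘ₗ s) ?_
    rintro _ ⟨x, hx, rfl⟩
    change j (φ (s (i x))) c = 0
    rw [hsi, show φ x = 0 from hx, map_zero, Finsupp.zero_apply]
  have hXr : X ≤ S.rad • ⊤ := by
    refine (Submodule.map_mono hker).trans ?_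
    rw [Submodule.map_smul'']
    exact smul_mono_right _ le_top
  have hx : i m.1 ∈ X := ⟨m.1, m.2, rfl⟩
  have hxv : S.vtx v • i m.1 = i m.1 := by
    rw [← map_smul]
    exact congrArg i (congrArg Subtype.val hv)
  have hxr : i m.1 ∉ S.rad • X := by
    rw [← Submodule.map_smul'']
    rintro ⟨y, hy, hym⟩
    obtain rfl := hinj hym
    refine hm ?_
    have h1 : S.rad • LinearMap.ker φ =
        (S.rad • (⊤ : Submodule R (LinearMap.ker φ))).map (LinearMap.ker φ).subtype := by
      rw [Submodule.map_smul'', Submodule.map_subtype_top]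
    obtain ⟨y, hy, hym⟩ := (h1 ▸ hy :)
    exact (Subtype.ext hym : y = m) ▸ hy
  obtain ⟨a, p, hp, hlen, ⟨y, hy, hy0⟩, i', r', hr⟩ := S.exists_path_retract hX hXr hx hxv hxr
  refine ⟨a, p, hp, hlen, fun ha => hy0 ?_, fun n hn => ?_⟩
  -- A source `a` kills the radicals of `P` and `Q`. So `a P` lies in `ker φ`, hence in the radical
  -- of `P`, hence is zero, and then `p y` vanishes because `p = p a`.
  · have h1 (z : P) : S.vtx a • z = 0 := by
      have h2 : S.vtx a • z ∈ LinearMap.ker φ := by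
        rw [LinearMap.mem_ker, map_smul]
        exact S.vtx_smul_of_isSource ha (hφ z)
      rw [← S.vtx_mul_vtx, mul_smul]
      exact S.vtx_smul_of_isSource ha (hker h2)
    obtain ⟨z, -, hz⟩ := hy
    rw [← hz, ← hsi z, hz, map_smul, ← S.path_mul_vtx, mul_smul, h1, smul_zero, map_zero]
  · have h1 : PdLT R X n :=
      (pdLT_congr (Submodule.equivMapOfInjective i hinj (LinearMap.ker φ)) n).1 hn
    exact h1.of_bijective i' r' hr

/-- Restricting a second syzygy `ker φ` along a surjective ring homomorphism `f` that is injective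
on the projective modules which belong to the ends of critical paths. -/
theorem restrictPdLT_ker {A : Type u} [Ring A] (f : A →+* R) (hf : Function.Surjective f)
    (e : W → A) (he : ∀ v, IsIdempotentElem (e v)) (hfe : ∀ v, f (e v) = S.vtx v)
    (hinj : ∀ (a v : W) (p : Quiver.Path a v), S.path ⟨a, v, p⟩ ≠ 0 → 0 < p.length →
      ¬ IsSource a → (∃ n, PdLT R (Ideal.span {S.path ⟨a, v, p⟩} : Ideal R) n) →
      ∀ x, f (x * e v) = 0 → x * e v = 0)
    (hker : LinearMap.ker φ ≤ S.rad • ⊤) (hφ : ∀ x, φ x ∈ S.rad • (⊤ : Submodule R Q)) {n : ℕ}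
    (hn : PdLT R (LinearMap.ker φ) n) : RestrictPdLT f (LinearMap.ker φ) n := by
  induction n generalizing P Q with
  | zero => exact (restrictPdLT_zero_iff f).2 (pdLT_zero_iff.1 hn)
  | succ n ih =>
    obtain ⟨ι, v, g, hg, hgker, hgv⟩ := S.exists_cover (M := LinearMap.ker φ)
    have hF : RestrictPdLT f (Π₀ i, (Ideal.span {S.vtx (v i)} : Ideal R)) 1 := by
      have hev : (fun i => S.vtx (v i)) = fun i => f (e (v i)) := funext fun i => (hfe _).symm
      -- The whole family becomes a variable, so that the ideals and their module structures are
      -- rewritten together.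
      generalize hw : (fun i => S.vtx (v i)) = w at hev
      have h := restrictPdLT_dfinsupp f hf (fun i => e (v i)) (fun i => he _) fun i => by
        -- Each summand of the cover belongs to a generator of the syzygy, hence to a path whose
        -- left ideal inherits the bound on projective dimension.
        obtain ⟨m, hmv, hm⟩ := hgv i
        obtain ⟨a, p, hp, hlen, ha, hpd⟩ := S.exists_path_of_notMem_rad_smul hker hφ hmv hm
        exact hinj a (v i) p hp hlen ha ⟨_, hpd _ hn⟩
      change RestrictPdLT f (Π₀ i, (Ideal.span {(fun i => S.vtx (v i)) i} : Ideal R)) 1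
      rw [hw, hev]
      exact h
    cases n with
    | zero =>
      have := pdLT_one_iff.1 hn
      obtain ⟨s, hs⟩ := Module.projective_lifting_property g LinearMap.id hg
      exact hF.of_rightInverse f s g hs
    | succ n =>
      rw [restrictPdLT_ker_iff f hF hg]
      -- The kernel of the cover is again a second syzygy: it is the kernel of a map between the
      -- projectives `F` and `P` with image in `ker φ`, hence in the radical of `P`.
      have h1 : LinearMap.ker ((LinearMap.ker φ).subtype ∘ₗ g) = LinearMap.ker g :=
        LinearMap.ker_comp_of_ker_eq_bot _ (Submodule.ker_subtype _)
      have h2 := ih (φ := (LinearMap.ker φ).subtype ∘ₗ g) (h1 ▸ hgker)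
        (fun x => hker (g x).2) (by rw [h1]; exact (pdLT_ker_iff hg n).1 hn)
      rwa [h1] at h2

end PathBasis

open PathAlgebra

/-! ### Quotients of path algebras and their corners -/

theorem PathAlgebra.span_range_of (K V : Type u) [Field K] [Quiver.{u} V] :
    Submodule.span K (Set.range (of K : TotalPath V → PathAlgebra K V)) = ⊤ := by
  rw [← Submodule.ker_mkQ (Submodule.span K (Set.range (of K))), LinearMap.ker_eq_top]
  refine hom_ext fun p => ?_
  rw [LinearMap.zero_apply, Submodule.mkQ_apply, Submodule.Quotient.mk_eq_zero]
  exact Submodule.subset_span ⟨p, rfl⟩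

theorem finite_setOf_length_lt (W : Type u) [Quiver.{u} W] [Finite W]
    [∀ a b : W, Finite (a ⟶ b)] (n : ℕ) : {p : TotalPath W | p.2.2.length < n}.Finite := by
  induction n with
  | zero => exact Set.finite_empty.subset fun p hp => absurd hp (Nat.not_lt_zero _)
  | succ n ih =>
    refine ((Set.finite_range fun v : W => (⟨v, v, Quiver.Path.nil⟩ : TotalPath W)).union
      (ih.biUnion fun p _ => Set.finite_iUnion fun c : W => Set.finite_range
        fun α : p.2.1 ⟶ c => (⟨p.1, c, p.2.2.cons α⟩ : TotalPath W))).subset ?_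
    rintro ⟨a, b, p⟩ hp
    cases p with
    | nil => exact Or.inl ⟨a, rfl⟩
    | @cons b' _ p α =>
      exact Or.inr (Set.mem_biUnion (x := ⟨a, b', p⟩)
        (show p.length < n from Nat.lt_of_succ_lt_succ hp)
        (Set.mem_iUnion.2 ⟨b, α, rfl⟩))

theorem PathSystem.isNoetherianRing {K W R : Type u} [Field K] [Quiver.{u} W] [Fintype W]
    [∀ a b : W, Finite (a ⟶ b)] [Ring R] [Algebra K R] (S : PathSystem K W R) :
    IsNoetherianRing R := by
  obtain ⟨m, hm⟩ := S.exists_path_eq_zero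
  have : Module.Finite K R := by
    refine ⟨Submodule.fg_def.2 ⟨S.path '' {p | p.2.2.length < m},
      (finite_setOf_length_lt W m).image _, top_le_iff.1 ?_⟩⟩
    rw [← S.span_range_path, Submodule.span_le]
    rintro _ ⟨p, rfl⟩
    by_cases hp : p.2.2.length < m
    · exact Submodule.subset_span ⟨p, hp, rfl⟩
    · rw [hm p (not_lt.1 hp)]
      exact zero_mem _
  exact IsNoetherianRing.of_finite K R

section

variable {K V : Type u} [Field K] [Quiver.{u} V]

theorem length_inclPath (E : Finset V) (p : TotalPath (FullSubquiver E)) :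
    (inclPath E p).2.2.length = p.2.2.length := by
  obtain ⟨a, b, p⟩ := p
  induction p with
  | nil => rfl
  | cons p α ih => exact congrArg Nat.succ ih

theorem inclLin_of (E : Finset V) (p : TotalPath (FullSubquiver E)) :
    inclLin K E (of K p) = of K (inclPath E p) := Finsupp.mapDomain_single

theorem of_inclPath_mul_of_inclPath {E : Finset V} {a b c : FullSubquiver E}
    (p : Quiver.Path b c) (q : Quiver.Path a b) :
    of K (inclPath E ⟨b, c, p⟩) * of K (inclPath E ⟨a, b, q⟩) =
      of K (inclPath E ⟨a, c, q.comp p⟩) :=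
  (of_mul_of_comp ((FullSubquiver.incl E).mapPath p) ((FullSubquiver.incl E).mapPath q)).trans
    (congrArg (fun r => of K (⟨a.1, c.1, r⟩ : TotalPath V)) (Prefunctor.mapPath_comp _ q p).symm)

theorem of_inclPath_mul_of_inclPath_of_ne {E : Finset V} {p q : TotalPath (FullSubquiver E)}
    (h : p.1 ≠ q.2.1) : of K (inclPath E p) * of K (inclPath E q) = 0 :=
  of_mul_of_ne fun h' => h (Subtype.ext h')

theorem vertexSum_mul_inclLin_mul (E : Finset V) (x : PathAlgebra K (FullSubquiver E)) :
    vertexSum K E * inclLin K E x * vertexSum K E = inclLin K E x := by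
  refine LinearMap.congr_fun (f := ((mulLin K V).flip (vertexSum K E)).comp
    ((mulLin K V (vertexSum K E)).comp (inclLin K E))) (g := inclLin K E) (hom_ext fun p => ?_) x
  change vertexSum K E * inclLin K E (of K p) * vertexSum K E = inclLin K E (of K p)
  rw [inclLin_of, vertexSum_mul_of, if_pos (by exact p.2.1.2), of_mul_vertexSum,
    if_pos (by exact p.1.2)]

variable [Fintype V]

variable (I : Ideal (PathAlgebra K V)) [I.IsTwoSided]

variable {I} in
/-- The images of the paths in an admissible quotient of a path algebra. -/
noncomputable def IsAdmissible.pathSystem (hI : IsAdmissible I) :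
    PathSystem K V (PathAlgebra K V ⧸ I) where
  path p := Ideal.Quotient.mk I (of K p)
  path_mul_path p q := by rw [← map_mul, of_mul_of_comp]
  path_mul_path_of_ne h := by rw [← map_mul, of_mul_of_ne h, map_zero]
  sum_path_nil := by
    rw [← map_sum]
    exact map_one (Ideal.Quotient.mk I)
  span_range_path := by
    have h := congrArg (Submodule.map (Ideal.Quotient.mkₐ K I).toLinearMap) (span_range_of K V)
    rw [Submodule.map_span, Submodule.map_top, LinearMap.range_eq_top.2
      (Ideal.Quotient.mkₐ_surjective K I), ← Set.range_comp] at h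
    exact h
  exists_path_eq_zero := by
    obtain ⟨m, hm⟩ := hI.exists_length_le
    exact ⟨m, fun p hp => Ideal.Quotient.eq_zero_iff_mem.2 (hm p hp)⟩

theorem IsAdmissible.pathSystem_path {I : Ideal (PathAlgebra K V)} [I.IsTwoSided]
    (hI : IsAdmissible I) (p : TotalPath V) :
    hI.pathSystem.path p = Ideal.Quotient.mk I (of K p) := rfl

theorem IsAdmissible.vertex_notMem {I : Ideal (PathAlgebra K V)}
    (hI : IsAdmissible I) (v : V) : vertex K v ∉ I := by
  intro hv
  refine absurd (hI.two_le_length _ hv ⟨v, v, Quiver.Path.nil⟩ ?_) (Nat.not_succ_le_zero 1)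
  have h : coeff (vertex K v) ⟨v, v, Quiver.Path.nil⟩ = 1 := Finsupp.single_eq_same
  rw [h]
  exact one_ne_zero

variable (E : Finset V)

noncomputable instance : SMul K (CornerAlg I E) :=
  ⟨fun c x => ⟨c • x.1, by
    obtain ⟨y, hy⟩ := x.2
    exact ⟨c • y, by
      change idem I E * (c • y) * idem I E = c • x.1
      rw [mul_smul_comm, smul_mul_assoc]
      exact congrArg (c • ·) hy⟩⟩⟩

theorem coe_smul_cornerAlg (c : K) (x : CornerAlg I E) : (c • x).1 = c • x.1 := rfl

noncomputable instance : Module K (CornerAlg I E) :=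
  Function.Injective.module K
    ({ toFun := Subtype.val, map_zero' := rfl, map_add' := fun _ _ => rfl } :
      CornerAlg I E →+ PathAlgebra K V ⧸ I) Subtype.val_injective (coe_smul_cornerAlg I E)

noncomputable instance : Algebra K (CornerAlg I E) :=
  Algebra.ofModule (fun c x y => Subtype.ext (smul_mul_assoc c x.1 y.1))
    fun c x y => Subtype.ext (mul_smul_comm c x.1 y.1)

/-- The linear map `x ↦ e x e` from the path algebra to the corner algebra. -/
noncomputable def cornerLin : PathAlgebra K V →ₗ[K] CornerAlg I E where
  toFun x := toCorner I E (Ideal.Quotient.mk I x)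
  map_add' x y := Subtype.ext (by
    change idem I E * Ideal.Quotient.mk I (x + y) * idem I E =
      idem I E * Ideal.Quotient.mk I x * idem I E + idem I E * Ideal.Quotient.mk I y * idem I E
    rw [map_add, mul_add, add_mul])
  map_smul' c x := Subtype.ext (by
    change idem I E * Ideal.Quotient.mkₐ K I (c • x) * idem I E =
      c • (idem I E * Ideal.Quotient.mkₐ K I x * idem I E)
    rw [map_smul, mul_smul_comm, smul_mul_assoc])

theorem toCorner_mk_eq_zero_iff (x : PathAlgebra K V) :
    toCorner I E (Ideal.Quotient.mk I x) = 0 ↔ vertexSum K E * x * vertexSum K E ∈ I := by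
  rw [← Ideal.Quotient.eq_zero_iff_mem, map_mul, map_mul]
  exact Subtype.ext_iff

theorem toCorner_inclLin_eq_zero_iff (x : PathAlgebra K (FullSubquiver E)) :
    toCorner I E (Ideal.Quotient.mk I (inclLin K E x)) = 0 ↔ inclLin K E x ∈ I := by
  rw [toCorner_mk_eq_zero_iff, vertexSum_mul_inclLin_mul]

theorem toCorner_inclPath_eq_zero_iff (p : TotalPath (FullSubquiver E)) :
    toCorner I E (Ideal.Quotient.mk I (of K (inclPath E p))) = 0 ↔ of K (inclPath E p) ∈ I := by
  rw [← inclLin_of, toCorner_inclLin_eq_zero_iff]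

variable {I E}

/-- If the restriction of `I` to a full subquiver is generated by paths, then it is spanned by
paths. -/
theorem IsMonomialOn.mem_span (h : IsMonomialOn I E) {x : PathAlgebra K (FullSubquiver E)}
    (hx : inclLin K E x ∈ I) :
    x ∈ Submodule.span K (of K '' {p | of K (inclPath E p) ∈ I}) := by
  obtain ⟨G, hG⟩ := h
  set T := Submodule.span K (of K '' {p | of K (inclPath E p) ∈ I})
  have hof (p q : TotalPath (FullSubquiver E))
      (hpq : of K (inclPath E p) ∈ I ∨ of K (inclPath E q) ∈ I) : of K p * of K q ∈ T := by
    by_cases h : p.1 = q.2.1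
    · obtain ⟨a, b, p⟩ := p
      obtain ⟨c, d, q⟩ := q
      obtain rfl : a = d := h
      rw [of_mul_of_comp]
      refine Submodule.subset_span ⟨_, ?_, rfl⟩
      rw [Set.mem_ofPred_eq, ← of_inclPath_mul_of_inclPath]
      exact hpq.elim (fun h => I.mul_mem_right _ h) (fun h => I.mul_mem_left _ h)
    · rw [of_mul_of_ne h]
      exact zero_mem _
  have hspan (x : PathAlgebra K (FullSubquiver E)) : x ∈ Submodule.span K (Set.range (of K)) := by
    rw [span_range_of]
    exact Submodule.mem_top
  have hleft {x y : PathAlgebra K (FullSubquiver E)} (hy : y ∈ T) : x * y ∈ T := by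
    induction hspan x using Submodule.span_induction with
    | mem x h =>
      obtain ⟨p, rfl⟩ := h
      induction hy using Submodule.span_induction with
      | mem y h =>
        obtain ⟨q, hq, rfl⟩ := h
        exact hof p q (Or.inr hq)
      | zero => rw [mul_zero]; exact zero_mem _
      | add y z _ _ hy hz => rw [mul_add]; exact add_mem hy hz
      | smul c y _ hy => rw [PathAlgebra.mul_smul']; exact T.smul_mem c hy
    | zero => rw [zero_mul]; exact zero_mem _
    | add x z _ _ hx hz => rw [add_mul]; exact add_mem hx hz
    | smul c x _ hx => rw [PathAlgebra.smul_mul']; exact T.smul_mem c hx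
  have hright {x y : PathAlgebra K (FullSubquiver E)} (hx : x ∈ T) : x * y ∈ T := by
    induction hspan y using Submodule.span_induction with
    | mem y h =>
      obtain ⟨q, rfl⟩ := h
      induction hx using Submodule.span_induction with
      | mem x h =>
        obtain ⟨p, hp, rfl⟩ := h
        exact hof p q (Or.inl hp)
      | zero => rw [zero_mul]; exact zero_mem _
      | add x z _ _ hx hz => rw [add_mul]; exact add_mem hx hz
      | smul c x _ hx => rw [PathAlgebra.smul_mul']; exact T.smul_mem c hx
    | zero => rw [mul_zero]; exact zero_mem _
    | add y z _ _ hy hz => rw [mul_add]; exact add_mem hy hz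
    | smul c y _ hy => rw [PathAlgebra.mul_smul']; exact T.smul_mem c hy
  -- The span `T` is a two-sided ideal that contains the generating paths, so it contains the whole
  -- restriction of `I`.
  let J : TwoSidedIdeal (PathAlgebra K (FullSubquiver E)) :=
    TwoSidedIdeal.mk' T T.zero_mem T.add_mem T.neg_mem hleft hright
  have hJ (x : PathAlgebra K (FullSubquiver E)) : x ∈ J ↔ x ∈ T := TwoSidedIdeal.mem_mk' ..
  have hle : TwoSidedIdeal.span (of K '' G) ≤ J := by
    rw [TwoSidedIdeal.span_le]
    rintro _ ⟨p, hp, rfl⟩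
    refine (hJ _).2 (Submodule.subset_span ⟨p, ?_, rfl⟩)
    have h : of K p ∈ inclLin K E ⁻¹' (I : Set (PathAlgebra K V)) :=
      hG ▸ TwoSidedIdeal.subset_span ⟨p, hp, rfl⟩
    rw [Set.mem_ofPred_eq, ← inclLin_of]
    exact h
  exact (hJ x).1 (hle (show x ∈ (TwoSidedIdeal.span (of K '' G) : Set _) from hG ▸ hx))

/-- A path of the quiver that ends in `E''` is a path of the full subquiver on `E''`. -/
theorem IsStackingPartition.exists_inclPath {I : Ideal (PathAlgebra K V)} {E' E'' : Finset V}
    (h : IsStackingPartition I E' E'') (p : TotalPath V) (hp : p.2.1 ∈ E'') :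
    ∃ q : TotalPath (FullSubquiver E''), inclPath E'' q = p := by
  obtain ⟨a, b, p⟩ := p
  suffices H : ∃ (ha : a ∈ E'') (q : Quiver.Path (V := FullSubquiver E'') ⟨a, ha⟩ ⟨b, hp⟩),
      (FullSubquiver.incl E'').mapPath q = p by
    obtain ⟨ha, q, hq⟩ := H
    exact ⟨⟨⟨a, ha⟩, ⟨b, hp⟩, q⟩, congrArg (fun r => (⟨a, b, r⟩ : TotalPath V)) hq⟩
  induction p with
  | nil => exact ⟨hp, Quiver.Path.nil, rfl⟩
  | @cons b c p α ih =>
    have hb : b ∈ E'' := (h.cover b).resolve_left fun hb =>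
      Finset.disjoint_left.1 h.disjoint (h.arrow α hb) hp
    obtain ⟨ha, q, hq⟩ := ih hb
    exact ⟨ha, q.cons (V := FullSubquiver E'') (b := ⟨b, hb⟩) (c := ⟨c, hp⟩) α,
      congrArg (Quiver.Path.cons · α) hq⟩

/-! ### Λ'' as a quotient of Λ -/

variable {E' E'' : Finset V}

theorem IsStackingPartition.proj_mk_of_eq_zero (h : IsStackingPartition I E' E'')
    {p : TotalPath V} (hp : p.2.1 ∉ E'') : h.proj (Ideal.Quotient.mk I (of K p)) = 0 := by
  refine (toCorner_mk_eq_zero_iff I E'' _).2 ?_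
  rw [vertexSum_mul_of, if_neg hp, zero_mul]
  exact I.zero_mem

theorem IsStackingPartition.proj_surjective (h : IsStackingPartition I E' E'') :
    Function.Surjective h.proj := by
  rintro ⟨_, x, rfl⟩
  exact ⟨x, rfl⟩

theorem IsStackingPartition.idem_add_idem (h : IsStackingPartition I E' E'') :
    idem I E' + idem I E'' = 1 := by
  classical
  rw [idem, idem, ← map_add, vertexSum, vertexSum, ← Finset.sum_union h.disjoint,
    show E' ∪ E'' = Finset.univ from Finset.eq_univ_of_forall fun v =>
      Finset.mem_union.2 (h.cover v)]
  exact map_one (Ideal.Quotient.mk I)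

/-- Like `idem_mul`, this says `e'' Λ e' = 0`; put `e' = 1 - e''`. -/
theorem IsStackingPartition.mul_idem (h : IsStackingPartition I E' E'')
    (x : PathAlgebra K V ⧸ I) : idem I E' * x * idem I E' = x * idem I E' := by
  have h1 := h.idem_mul x
  rw [eq_sub_of_add_eq h.idem_add_idem]
  simp only [sub_mul, mul_sub, one_mul, mul_one, h1]
  abel

/-- The images of the paths of the subquiver on `E''` in the algebra `Λ''`. -/
noncomputable def IsStackingPartition.pathSystem (h : IsStackingPartition I E' E'')
    (hI : IsAdmissible I) : PathSystem K (FullSubquiver E'') (CornerAlg I E'') where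
  path p := h.proj (Ideal.Quotient.mk I (of K (inclPath E'' p)))
  path_mul_path p q := by rw [← map_mul, ← map_mul, of_inclPath_mul_of_inclPath]
  path_mul_path_of_ne hpq := by
    rw [← map_mul, ← map_mul, of_inclPath_mul_of_inclPath_of_ne hpq, map_zero, map_zero]
  sum_path_nil := by
    rw [← map_sum, ← map_sum]
    have h1 : ∑ v : FullSubquiver E'', of K (inclPath E'' ⟨v, v, Quiver.Path.nil⟩) =
        vertexSum K E'' := Finset.sum_coe_sort E'' (vertex K)
    rw [h1, ← map_one h.proj]
    refine Subtype.ext ?_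
    change idem I E'' * idem I E'' * idem I E'' = idem I E'' * 1 * idem I E''
    rw [isIdempotentElem_idem, mul_one]
  span_range_path := by
    have h1 : Function.Surjective (cornerLin I E'') := fun x => by
      obtain ⟨y, rfl⟩ := h.proj_surjective x
      obtain ⟨z, rfl⟩ := Ideal.Quotient.mk_surjective y
      exact ⟨z, rfl⟩
    rw [eq_top_iff, ← LinearMap.range_eq_top.2 h1, ← Submodule.map_top, ← span_range_of,
      Submodule.map_span, Submodule.span_le]
    rintro _ ⟨_, ⟨p, rfl⟩, rfl⟩
    by_cases hp : p.2.1 ∈ E''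
    · obtain ⟨q, rfl⟩ := h.exists_inclPath p hp
      exact Submodule.subset_span ⟨q, rfl⟩
    · rw [show cornerLin I E'' (of K p) = 0 from h.proj_mk_of_eq_zero hp]
      exact zero_mem _
  exists_path_eq_zero := by
    obtain ⟨m, hm⟩ := hI.exists_length_le
    refine ⟨m, fun p hp => ?_⟩
    rw [Ideal.Quotient.eq_zero_iff_mem.2 (hm _ ((length_inclPath E'' p).symm ▸ hp)), map_zero]

theorem IsStackingPartition.pathSystem_path_eq_zero_iff (h : IsStackingPartition I E' E'')
    (hI : IsAdmissible I) (p : TotalPath (FullSubquiver E'')) :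
    (h.pathSystem hI).path p = 0 ↔ of K (inclPath E'' p) ∈ I :=
  toCorner_inclPath_eq_zero_iff I E'' p

/-- If `Λ''` is monomial, then the nonzero paths form a basis of it. -/
theorem IsStackingPartition.exists_pathBasis [∀ a b : V, Finite (a ⟶ b)]
    (h : IsStackingPartition I E' E'') (hI : IsAdmissible I) (hmon : IsMonomialOn I E'') :
    ∃ S : PathBasis K (FullSubquiver E'') (CornerAlg I E''),
      S.toPathSystem = h.pathSystem hI := by
  classical
  set S := h.pathSystem hI
  let c : PathAlgebra K (FullSubquiver E'') →ₗ[K] (TotalPath (FullSubquiver E'') →₀ K) :=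
    (Finsupp.linearCombination K fun p =>
      if S.path p = 0 then (0 : TotalPath (FullSubquiver E'') →₀ K) else Finsupp.single p 1 :
      (TotalPath (FullSubquiver E'') →₀ K) →ₗ[K] _)
  have hc (p : TotalPath (FullSubquiver E'')) :
      c (of K p) = if S.path p = 0 then 0 else Finsupp.single p 1 :=
    (Finsupp.linearCombination_single K 1 p).trans (one_smul K _)
  have hπ (p : TotalPath (FullSubquiver E'')) :
      (cornerLin I E'' ∘ₗ inclLin K E'') (of K p) = S.path p := by
    rw [LinearMap.comp_apply, inclLin_of]
    rfl
  have hker (x : PathAlgebra K (FullSubquiver E''))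
      (hx : (cornerLin I E'' ∘ₗ inclLin K E'') x = 0) : c x = 0 := by
    have hx' := hmon.mem_span ((toCorner_inclLin_eq_zero_iff I E'' x).1 hx)
    refine (Submodule.span_le (p := LinearMap.ker c)).2 ?_ hx'
    rintro _ ⟨p, hp, rfl⟩
    exact (hc p).trans (if_pos ((h.pathSystem_path_eq_zero_iff hI p).2 hp))
  -- Any linear section will do: `c` vanishes on the kernel of the projection, so `c ∘ σ` does not
  -- depend on the choice.
  obtain ⟨σ, hσ⟩ := (cornerLin I E'' ∘ₗ inclLin K E'').exists_rightInverse_of_surjective (by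
    rw [eq_top_iff, ← S.span_range_path, Submodule.span_le]
    rintro _ ⟨p, rfl⟩
    exact ⟨of K p, hπ p⟩)
  obtain ⟨m, hm⟩ := S.exists_path_eq_zero
  refine ⟨{ S with
    coef := c ∘ₗ σ
    coef_path := fun p hp => ?_
    finite_path_ne_zero := (finite_setOf_length_lt (FullSubquiver E'') m).subset fun p hp =>
      not_le.1 fun hl => hp (hm p hl) }, rfl⟩
  have h1 : c (σ (S.path p) - of K p) = 0 := by
    refine hker _ ?_
    rw [map_sub, hπ, ← LinearMap.comp_apply, hσ, LinearMap.id_apply, sub_self]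
  rw [map_sub, sub_eq_zero, hc, if_neg hp] at h1
  exact h1

/-- The projection kills the paths that do not end in `E''` and keeps the length of the others. -/
theorem IsStackingPartition.proj_mem_rad (h : IsStackingPartition I E' E'')
    (hI : IsAdmissible I) {x : PathAlgebra K V ⧸ I} (hx : x ∈ hI.pathSystem.rad) :
    h.proj x ∈ (h.pathSystem hI).rad := by
  induction hx using Submodule.span_induction with
  | mem x hx =>
    obtain ⟨p, hp, rfl⟩ := hx
    rw [hI.pathSystem_path]
    by_cases hpE : p.2.1 ∈ E''
    · obtain ⟨q, rfl⟩ := h.exists_inclPath p hpE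
      exact (h.pathSystem hI).path_mem_rad ((length_inclPath E'' q) ▸ hp)
    · rw [h.proj_mk_of_eq_zero hpE]
      exact zero_mem _
  | zero => rw [map_zero]; exact zero_mem _
  | add x y _ _ hx hy => rw [map_add]; exact add_mem hx hy
  | smul y x _ hx => rw [smul_eq_mul, map_mul]; exact Ideal.mul_mem_left _ _ hx

/-- Passing to the corner at `e''` maps the radical of a module into the radical. -/
theorem IsStackingPartition.mem_rad_smul_cornerPart (h : IsStackingPartition I E' E'')
    (hI : IsAdmissible I) {M : Type u} [AddCommGroup M] [Module (PathAlgebra K V ⧸ I) M]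
    {x : cornerPart (isIdempotentElem_idem I E'') M}
    (hx : x.1 ∈ hI.pathSystem.rad • (⊤ : Submodule (PathAlgebra K V ⧸ I) M)) :
    x ∈ (h.pathSystem hI).rad •
      (⊤ : Submodule (CornerAlg I E'') (cornerPart (isIdempotentElem_idem I E'') M)) := by
  have key (m : M) (hm : m ∈ hI.pathSystem.rad • (⊤ : Submodule (PathAlgebra K V ⧸ I) M)) :
      (⟨idem I E'' • m, smul_mem_cornerPart _ m⟩ :
        cornerPart (isIdempotentElem_idem I E'') M) ∈ (h.pathSystem hI).rad •
      (⊤ : Submodule (CornerAlg I E'') (cornerPart (isIdempotentElem_idem I E'') M)) := by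
    induction hm using Submodule.smul_induction_on' with
    | smul r hr m _ =>
      have h1 := Submodule.smul_mem_smul (h.proj_mem_rad hI hr) (Submodule.mem_top
        (x := (⟨idem I E'' • m, smul_mem_cornerPart _ m⟩ :
          cornerPart (isIdempotentElem_idem I E'') M)))
      convert h1 using 1
      refine Subtype.ext ?_
      change idem I E'' • r • m = (idem I E'' * r * idem I E'') • idem I E'' • m
      rw [h.idem_mul, smul_smul, smul_smul, h.idem_mul]
    | add x _ y _ hx hy =>
      convert add_mem hx hy using 1
      exact Subtype.ext (smul_add _ _ _)
  have h1 := key x.1 hx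
  rwa [show (⟨idem I E'' • x.1, smul_mem_cornerPart _ x.1⟩ :
    cornerPart (isIdempotentElem_idem I E'') M) = x from Subtype.ext x.2] at h1

/-- All paths from a homogeneous non-source of `E''` to `E'` vanish. -/
theorem IsStackingPartition.of_mem (h : IsStackingPartition I E' E'')
    {v : FullSubquiver E''} (hv : IsHomogeneous E'' v) (hvs : ¬ IsSource v.1) {w : V}
    (p : Quiver.Path v.1 w) (hw : w ∈ E') : of K ⟨v.1, w, p⟩ ∈ I := by
  induction p with
  | nil => exact absurd v.2 (Finset.disjoint_left.1 h.disjoint hw)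
  | @cons b c p α ih =>
    rw [← Quiver.Path.comp_toPath_eq_cons, ← of_mul_of_comp]
    rcases h.cover b with hb | hb
    · exact I.mul_mem_left _ (ih hb)
    · cases p with
      | nil => exact absurd (hv c α) (Finset.disjoint_left.1 h.disjoint hw)
      | @cons a _ p β =>
        rw [← Quiver.Path.comp_toPath_eq_cons, ← of_mul_of_comp, ← mul_assoc, of_mul_of_comp]
        -- If `β` followed by `α` were nonzero, the stacking condition would make the start of `β` a
        -- source; but it is either `v` or the end of an arrow.
        refine I.mul_mem_right _ (by_contra fun hn => ?_)
        have ha := h.source β α hb hw hn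
        cases p with
        | nil => exact hvs ha
        | cons p γ => exact (ha _).false γ

/-- The component `e' x v` is zero because all paths from `v` to `E'` vanish, and `e'' x v` is the
projection of `x v`, zero by assumption. Thus the projection is injective on Λv. -/
theorem IsStackingPartition.mul_vertex_eq_zero (h : IsStackingPartition I E' E'')
    {v : FullSubquiver E''} (hv : IsHomogeneous E'' v) (hvs : ¬ IsSource v.1)
    {x : PathAlgebra K V ⧸ I} (hx : h.proj (x * Ideal.Quotient.mk I (vertex K v.1)) = 0) :
    x * Ideal.Quotient.mk I (vertex K v.1) = 0 := by
  have h1 (y : PathAlgebra K V) :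
      idem I E' * (Ideal.Quotient.mk I y * Ideal.Quotient.mk I (vertex K v.1)) = 0 := by
    rw [idem, ← map_mul, ← map_mul, Ideal.Quotient.eq_zero_iff_mem]
    have hy : y ∈ Submodule.span K (Set.range (of K)) := by
      rw [span_range_of]
      exact Submodule.mem_top
    induction hy using Submodule.span_induction with
    | mem y hy =>
      obtain ⟨⟨a, b, p⟩, rfl⟩ := hy
      by_cases ha : a = v.1
      · subst ha
        rw [vertex, of_mul_of_comp, vertexSum_mul_of]
        split_ifs with hb
        · exact h.of_mem hv hvs _ hb
        · exact I.zero_mem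
      · rw [vertex, of_mul_of_ne (by exact ha), mul_zero]
        exact I.zero_mem
    | zero => rw [zero_mul, mul_zero]; exact I.zero_mem
    | add y z _ _ hy hz => rw [add_mul, mul_add]; exact I.add_mem hy hz
    | smul c y _ hy =>
      rw [smul_mul_assoc, mul_smul_comm]
      exact Submodule.smul_of_tower_mem I c hy
  obtain ⟨y, rfl⟩ := Ideal.Quotient.mk_surjective x
  have h2 : idem I E'' * (Ideal.Quotient.mk I y * Ideal.Quotient.mk I (vertex K v.1)) = 0 := by
    rw [← h.idem_mul]
    exact congrArg Subtype.val hx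
  rw [← one_mul (Ideal.Quotient.mk I y * _), ← h.idem_add_idem, add_mul, h1, h2, add_zero]

end

/-! ### Stacking -/

theorem projectiveDimension_lt_top_iff {R : Type u} [Ring R] {X : ModuleCat.{u} R} :
    projectiveDimension X < ⊤ ↔ ∃ n : ℕ, HasProjectiveDimensionLT X n := by
  rw [lt_top_iff_ne_top, projectiveDimension_ne_top_iff]
  exact ⟨fun ⟨n, h⟩ => ⟨n + 1, h⟩,
    fun ⟨n, _⟩ => ⟨n, hasProjectiveDimensionLT_of_ge X n (n + 1) (Nat.le_succ n)⟩⟩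

theorem projectiveDimension_congr {R S : Type u} [Ring R] [Ring S] {X : ModuleCat.{u} R}
    {Y : ModuleCat.{u} S}
    (h : ∀ n : ℕ, HasProjectiveDimensionLT X n ↔ HasProjectiveDimensionLT Y n) :
    projectiveDimension X = projectiveDimension Y := by
  simp only [projectiveDimension, h]

section

variable {R M N : Type u} [Ring R] [AddCommGroup M] [Module R M] [AddCommGroup N] [Module R N]
  {f : M →ₗ[R] N} {n : ℕ}

theorem PdLT.of_ker (hf : Function.Surjective f) (hker : PdLT R (LinearMap.ker f) n)
    (hN : PdLT R N n) : PdLT R M n :=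
  (LinearMap.shortExact_shortComplexKer hf).hasProjectiveDimensionLT_X₂ n hker hN

theorem PdLT.ker (hf : Function.Surjective f) (hM : PdLT R M n) (hN : PdLT R N (n + 1)) :
    PdLT R (LinearMap.ker f) n :=
  (LinearMap.shortExact_shortComplexKer hf).hasProjectiveDimensionLT_X₁ n hM hN

end

theorem restrictPdLT_congr {R S M N : Type u} [Ring R] [Ring S] (f : R →+* S) [AddCommGroup M]
    [Module S M] [AddCommGroup N] [Module S N] (e : M ≃ₗ[S] N) (n : ℕ) :
    RestrictPdLT f M n ↔ RestrictPdLT f N n :=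
  ⟨fun _ => hasProjectiveDimensionLT_of_iso
      ((ModuleCat.restrictScalars f).mapIso e.toModuleIso) n,
    fun _ => hasProjectiveDimensionLT_of_iso
      ((ModuleCat.restrictScalars f).mapIso e.symm.toModuleIso) n⟩

theorem PathSystem.exists_isSyzygy_two {K W R : Type u} [Field K] [Quiver.{u} W] [Fintype W]
    [Ring R] [Algebra K R] (S : PathSystem K W R) (M : ModuleCat.{u} R) :
    ∃ X : ModuleCat.{u} R, IsSyzygy 2 M X := by
  obtain ⟨ι, v, f, hf, hfk, -⟩ := S.exists_cover (M := M)
  obtain ⟨κ, w, g, hg, hgk, -⟩ := S.exists_cover (M := LinearMap.ker f)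
  exact ⟨ModuleCat.of R (LinearMap.ker g), ModuleCat.of R _, f,
    (S.isProjectiveCover_iff (P := ModuleCat.of R _) f).2 ⟨inferInstance, hf, hfk⟩,
    ModuleCat.of R _, g,
    (S.isProjectiveCover_iff (P := ModuleCat.of R _) (N := ModuleCat.of R (LinearMap.ker f)) g).2
      ⟨inferInstance, hg, hgk⟩, ⟨Iso.refl _⟩⟩

variable {K V : Type u} [Field K] [Quiver.{u} V] [Fintype V] {I : Ideal (PathAlgebra K V)}
  [I.IsTwoSided] {E' E'' : Finset V}

namespace IsStackingPartition

theorem restrictPdLT_ker [∀ a b : V, Finite (a ⟶ b)] (h : IsStackingPartition I E' E'')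
    (hI : IsAdmissible I) (hmon : IsMonomialOn I E'')
    (hcrit : ∀ p : TotalPath (FullSubquiver E''), IsCritical I E'' p → IsHomogeneous E'' p.2.1)
    {P Q : Type u} [AddCommGroup P] [Module (CornerAlg I E'') P]
    [Module.Projective (CornerAlg I E'') P] [AddCommGroup Q] [Module (CornerAlg I E'') Q]
    [Module.Projective (CornerAlg I E'') Q] {φ : P →ₗ[CornerAlg I E''] Q}
    (hker : LinearMap.ker φ ≤ (h.pathSystem hI).rad • ⊤)
    (hφ : ∀ x, φ x ∈ (h.pathSystem hI).rad • (⊤ : Submodule (CornerAlg I E'') Q)) {n : ℕ}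
    (hn : PdLT (CornerAlg I E'') (LinearMap.ker φ) n) :
    RestrictPdLT h.proj (LinearMap.ker φ) n := by
  obtain ⟨S, hS⟩ := h.exists_pathBasis hI hmon
  have hpath (p : TotalPath (FullSubquiver E'')) :
      S.path p = toCorner I E'' (Ideal.Quotient.mk I (of K (inclPath E'' p))) := by
    rw [hS]
    rfl
  rw [← hS] at hker hφ
  refine S.restrictPdLT_ker h.proj h.proj_surjective
    (fun v => Ideal.Quotient.mk I (vertex K v.1)) (fun v => hI.pathSystem.vtx_mul_vtx v.1)
    (fun v => (hpath ⟨v, v, Quiver.Path.nil⟩).symm) ?_ hker hφ hn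
  intro a v p hp hlen ha hpd x hx
  refine h.mul_vertex_eq_zero (hcrit ⟨a, v, p⟩ ⟨?_, hlen, ha, ?_⟩) ?_ hx
  · rw [← toCorner_inclPath_eq_zero_iff, ← hpath]
    exact hp
  · rw [← hpath]
    exact projectiveDimension_lt_top_iff.2 hpd
  · intro hv
    cases p with
    | nil => exact absurd hlen (lt_irrefl 0)
    | cons p α => exact (hv _).false α

theorem proj_coe (h : IsStackingPartition I E' E'') (c : CornerAlg I E'') : h.proj c.1 = c := by
  refine Subtype.ext ?_
  obtain ⟨_, x, rfl⟩ := c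
  change idem I E'' * (idem I E'' * x * idem I E'') * idem I E'' =
    idem I E'' * x * idem I E''
  rw [h.idem_mul, h.idem_mul, ← mul_assoc, isIdempotentElem_idem]

theorem proj_idem (h : IsStackingPartition I E' E'') : h.proj (idem I E'') = 1 :=
  h.proj_coe 1

/-- Restricting a `Λ''`-module to `Λ` and passing to the corner at `e''` gives it back. -/
def cornerPartRestrict (h : IsStackingPartition I E' E'') (X : ModuleCat.{u} (CornerAlg I E'')) :
    cornerPart (isIdempotentElem_idem I E'') ((ModuleCat.restrictScalars h.proj).obj X)
      ≃ₗ[CornerAlg I E''] X where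
  toFun x := x.1
  invFun x := ⟨x, by
    change h.proj (idem I E'') • (show X from x) = x
    rw [h.proj_idem, one_smul]⟩
  map_add' _ _ := rfl
  map_smul' c x := by
    change h.proj c.1 • (show X from x.1) = c • (show X from x.1)
    rw [h.proj_coe]

/-- The projection of a `Λ`-module to its corner at `e''`. -/
noncomputable def toCornerPart (h : IsStackingPartition I E' E'') (M : Type u) [AddCommGroup M]
    [Module (PathAlgebra K V ⧸ I) M] :
    M →ₗ[PathAlgebra K V ⧸ I] (ModuleCat.restrictScalars h.proj).obj
      (ModuleCat.of (CornerAlg I E'') (cornerPart (isIdempotentElem_idem I E'') M)) where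
  toFun x := (⟨idem I E'' • x, smul_mem_cornerPart _ x⟩ :
    cornerPart (isIdempotentElem_idem I E'') M)
  map_add' x y := Subtype.ext (smul_add _ x y)
  map_smul' r x := by
    refine Subtype.ext ?_
    change idem I E'' • r • x = (idem I E'' * r * idem I E'') • idem I E'' • x
    rw [h.idem_mul, smul_smul, smul_smul, h.idem_mul]

theorem toCornerPart_surjective (h : IsStackingPartition I E' E'') (M : Type u) [AddCommGroup M]
    [Module (PathAlgebra K V ⧸ I) M] : Function.Surjective (h.toCornerPart M) :=
  fun y => ⟨y.1, Subtype.ext y.2⟩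

theorem idem_smul_of_mem_ker (h : IsStackingPartition I E' E'') {M : Type u} [AddCommGroup M]
    [Module (PathAlgebra K V ⧸ I) M] (x : LinearMap.ker (h.toCornerPart M)) :
    idem I E' • x = x := by
  have h0 : (⟨idem I E'' • x.1, smul_mem_cornerPart _ x.1⟩ :
      cornerPart (isIdempotentElem_idem I E'') M) = 0 := x.2
  have h2 : idem I E'' • x.1 = 0 := congrArg Subtype.val h0
  have h1 : idem I E'' • x = 0 := Subtype.ext h2
  rw [← add_zero (idem I E' • x), ← h1, ← add_smul, h.idem_add_idem, one_smul]

/-- Two successive covers present `X` as the kernel of a radical map between projectives, which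
bounds the dimension over Λ. Conversely, the corner of the restricted module is `X`. Stating this
for every `n` also compares infinite dimensions. -/
theorem hasProjectiveDimensionLT_iff_of_isSyzygy_two [∀ a b : V, Finite (a ⟶ b)]
    (h : IsStackingPartition I E' E'')
    (hI : IsAdmissible I) (hmon : IsMonomialOn I E'')
    (hcrit : ∀ p : TotalPath (FullSubquiver E''), IsCritical I E'' p → IsHomogeneous E'' p.2.1)
    {M X : ModuleCat.{u} (CornerAlg I E'')} (hX : IsSyzygy 2 M X) (n : ℕ) :
    HasProjectiveDimensionLT X n ↔
      HasProjectiveDimensionLT ((ModuleCat.restrictScalars h.proj).obj X) n := by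
  constructor
  · intro hn
    obtain ⟨P, f, hf, Q, g, hg, ⟨e⟩⟩ := hX
    rw [(h.pathSystem hI).isProjectiveCover_iff] at hf hg
    obtain ⟨_, -, hfk⟩ := hf
    obtain ⟨_, -, hgk⟩ := hg
    have h1 : LinearMap.ker ((LinearMap.ker f).subtype ∘ₗ g) = LinearMap.ker g :=
      LinearMap.ker_comp_of_ker_eq_bot _ (Submodule.ker_subtype _)
    have h2 : PdLT (CornerAlg I E'') (LinearMap.ker g) n :=
      hasProjectiveDimensionLT_of_iso e.symm n
    have h3 := h.restrictPdLT_ker hI hmon hcrit (φ := (LinearMap.ker f).subtype ∘ₗ g)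
      (h1 ▸ hgk) (fun x => hfk (g x).2) (n := n) (by rwa [h1])
    rw [h1] at h3
    exact hasProjectiveDimensionLT_of_iso ((ModuleCat.restrictScalars h.proj).mapIso e) n
  · intro hn
    exact (pdLT_congr (h.cornerPartRestrict X) n).1
      (PdLT.cornerPart (he := isIdempotentElem_idem I E'') h.idem_mul hn)

end IsStackingPartition

/-- If the idempotent were zero, `I` would contain a vertex, against admissibility. For Λ' this
keeps `finDim` from being `⊥`. -/
theorem IsAdmissible.nontrivial_cornerAlg (hI : IsAdmissible I) {E : Finset V}
    (hE : E.Nonempty) : Nontrivial (CornerAlg I E) := by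
  obtain ⟨v, hv⟩ := hE
  refine ⟨⟨1, 0, fun h => hI.vertex_notMem v ?_⟩⟩
  have h1 : Ideal.Quotient.mk I (vertexSum K E) = 0 := congrArg Subtype.val h
  have h2 : of K ⟨v, v, Quiver.Path.nil⟩ * vertexSum K E = vertex K v :=
    (of_mul_vertexSum E _).trans (if_pos hv)
  rw [← h2]
  exact I.mul_mem_left _ (Ideal.Quotient.eq_zero_iff_mem.1 h1)

theorem projectiveDimension_le_finDim {R : Type u} [Ring R] (M : ModuleCat.{u} R)
    [hM : Module.Finite R M] (h : projectiveDimension M < ⊤) :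
    projectiveDimension M ≤ finDim R :=
  le_iSup_of_le M (le_iSup_of_le hM (le_iSup_of_le h le_rfl))

theorem finDim_nonneg (R : Type u) [Ring R] [Nontrivial R] : 0 ≤ finDim R := by
  have h1 : PdLT R R 1 := pdLT_one_iff.2 inferInstance
  refine le_trans ?_ (projectiveDimension_le_finDim (ModuleCat.of R R)
    (projectiveDimension_lt_top_iff.2 ⟨1, h1⟩))
  refine (projectiveDimension_ge_iff (ModuleCat.of R R) 0).2 fun h0 => ?_
  exact not_subsingleton R (pdLT_zero_iff.1 h0)

namespace IsStackingPartition

/-- The kernel of M → e''M is e'M, of finite projective dimension like its neighbours. Over Λ' this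
dimension is the same, and there it is at most the finitistic dimension. -/
theorem pdLT_of_restrictPdLT_cornerPart (h : IsStackingPartition I E' E'') {M : Type u}
    [AddCommGroup M] [Module (PathAlgebra K V ⧸ I) M] [IsNoetherian (PathAlgebra K V ⧸ I) M]
    (hM : ∃ n, PdLT (PathAlgebra K V ⧸ I) M n) {j : ℕ} (hj : finDim (CornerAlg I E') ≤ j)
    (hres : RestrictPdLT h.proj (cornerPart (isIdempotentElem_idem I E'') M) (j + 1)) :
    PdLT (PathAlgebra K V ⧸ I) M (j + 1) := by
  obtain ⟨m, hm⟩ := hM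
  -- Only finiteness matters; `m + j` is large enough for both neighbours in the sequence.
  have hY1 : PdLT (PathAlgebra K V ⧸ I) (LinearMap.ker (h.toCornerPart M)) (m + j) :=
    PdLT.ker (h.toCornerPart_surjective M) (hm.mono (Nat.le_add_right m j))
      (hasProjectiveDimensionLT_of_ge _ (j + 1) _ (by omega))
  refine PdLT.of_ker (h.toCornerPart_surjective M) ?_ hres
  rw [pdLT_cornerPart_iff (he := isIdempotentElem_idem I E') h.mul_idem h.idem_smul_of_mem_ker]
    at hY1 ⊢
  have := finite_cornerPart (he := isIdempotentElem_idem I E') h.mul_idem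
    (M := LinearMap.ker (h.toCornerPart M)) h.idem_smul_of_mem_ker
  exact (projectiveDimension_le_iff _ j).1
    ((projectiveDimension_le_finDim (ModuleCat.of _ _)
      (projectiveDimension_lt_top_iff.2 ⟨_, hY1⟩)).trans hj)

/-- Beyond the finitistic dimension of `Λ'`, the projective dimension of a finitely generated
`Λ`-module is governed by its corner at `e''`. -/
theorem pdLT_of_pdLT_cornerPart [∀ a b : V, Finite (a ⟶ b)]
    (h : IsStackingPartition I E' E'') (hI : IsAdmissible I) (hmon : IsMonomialOn I E'')
    (hcrit : ∀ p : TotalPath (FullSubquiver E''), IsCritical I E'' p → IsHomogeneous E'' p.2.1)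
    {N : Type u} [AddCommGroup N] [Module (PathAlgebra K V ⧸ I) N]
    [Module.Finite (PathAlgebra K V ⧸ I) N] (hN : ∃ n, PdLT (PathAlgebra K V ⧸ I) N n) {j : ℕ}
    (hj : finDim (CornerAlg I E') ≤ j)
    (hNj : PdLT (CornerAlg I E'') (cornerPart (isIdempotentElem_idem I E'') N) (j + 3)) :
    PdLT (PathAlgebra K V ⧸ I) N (j + 3) := by
  obtain ⟨m, hm⟩ := hN
  replace hm := hm.mono (show m ≤ m + j + 3 by omega)
  have := hI.pathSystem.isNoetherianRing
  obtain ⟨ι, v, f, hf, hfk, -⟩ := hI.pathSystem.exists_cover (M := N)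
  have := hI.pathSystem.finite_of_ker_le hf hfk
  obtain ⟨κ, w, g, hg, hgk, -⟩ := hI.pathSystem.exists_cover (M := LinearMap.ker f)
  have := hI.pathSystem.finite_of_ker_le hg hgk
  have hP {M : Type u} [AddCommGroup M] [Module (PathAlgebra K V ⧸ I) M]
      [Module.Projective (PathAlgebra K V ⧸ I) M] : Module.Projective (CornerAlg I E'')
        (cornerPart (isIdempotentElem_idem I E'') M) := projective_cornerPart h.idem_mul
  rw [pdLT_cornerPart_ker_iff (pdLT_one_iff.2 hP) hf (j + 1),
    pdLT_cornerPart_ker_iff (pdLT_one_iff.2 hP) hg j] at hNj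
  rw [pdLT_ker_iff hf (m + j + 1), pdLT_ker_iff hg (m + j)] at hm
  rw [pdLT_ker_iff hf (j + 1), pdLT_ker_iff hg j]
  have hφ : LinearMap.ker ((LinearMap.ker f).subtype ∘ₗ g) = LinearMap.ker g :=
    LinearMap.ker_comp_of_ker_eq_bot _ (Submodule.ker_subtype _)
  rw [← hφ] at hgk hNj hm ⊢
  set φ := (LinearMap.ker f).subtype ∘ₗ g
  have hφf (x) : φ x ∈ LinearMap.ker f := (g x).2
  clear_value φ
  have hres : RestrictPdLT h.proj (cornerPart (isIdempotentElem_idem I E'') (LinearMap.ker φ))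
      (j + 1) := by
    have := hP (M := Π₀ i, (Ideal.span {hI.pathSystem.vtx (v i)} : Ideal _))
    have := hP (M := Π₀ i, (Ideal.span {hI.pathSystem.vtx (w i)} : Ideal _))
    refine (restrictPdLT_congr h.proj (M := LinearMap.ker (cornerMap _ φ))
      (kerCornerMap (isIdempotentElem_idem I E'') φ) _).1 ?_
    -- The corners of the Λ-covers serve directly as the projectives over Λ'': it suffices that
    -- radicals go into radicals.
    refine h.restrictPdLT_ker hI hmon hcrit (fun x hx => ?_) (fun x => ?_)
      ((pdLT_congr (kerCornerMap (isIdempotentElem_idem I E'') φ) _).2 hNj)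
    · exact h.mem_rad_smul_cornerPart hI (hgk (congrArg Subtype.val hx))
    · exact h.mem_rad_smul_cornerPart hI (hfk (hφf x.1))
  exact h.pdLT_of_restrictPdLT_cornerPart ⟨_, hm⟩ hj hres

end IsStackingPartition

end Stacks

theorem corollary9 {K V : Type u} [Field K] [Quiver.{u} V] [Fintype V]
    [∀ a b : V, Finite (a ⟶ b)]
    (I : Ideal (Stacks.PathAlgebra K V)) [I.IsTwoSided] (hI : Stacks.IsAdmissible I)
    (E' E'' : Finset V) (hE' : E'.Nonempty) (hE'' : E''.Nonempty)
    (h : Stacks.IsStackingPartition I E' E'')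
    (hmon : Stacks.IsMonomialOn I E'')
    (hcrit : ∀ p : Stacks.TotalPath (Stacks.FullSubquiver E''),
      Stacks.IsCritical I E'' p → Stacks.IsHomogeneous E'' p.2.1)
    (N : ModuleCat.{u} (Stacks.PathAlgebra K V ⧸ I))
    (hN : projectiveDimension N < ⊤) :
    ((∃ X : ModuleCat.{u} (Stacks.CornerAlg I E''), Stacks.IsSyzygy 2
        (ModuleCat.of _ (Stacks.cornerPart (Stacks.isIdempotentElem_idem I E'') N)) X) ∧
      ∀ X : ModuleCat.{u} (Stacks.CornerAlg I E''), Stacks.IsSyzygy 2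
        (ModuleCat.of _ (Stacks.cornerPart (Stacks.isIdempotentElem_idem I E'') N)) X →
        projectiveDimension X =
          projectiveDimension ((ModuleCat.restrictScalars h.proj).obj X)) ∧
    (Module.Finite (Stacks.PathAlgebra K V ⧸ I) N →
      Stacks.finDim (Stacks.CornerAlg I E') + 2 < projectiveDimension N →
      projectiveDimension
          (ModuleCat.of (Stacks.CornerAlg I E'')
            (Stacks.cornerPart (Stacks.isIdempotentElem_idem I E'') N)) =
        projectiveDimension N) := by

  refine ⟨⟨(h.pathSystem hI).exists_isSyzygy_two _, fun X hX => Stacks.projectiveDimension_congr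
    (h.hasProjectiveDimensionLT_iff_of_isSyzygy_two hI hmon hcrit hX)⟩, fun hfin hlt => ?_⟩
  have := hI.nontrivial_cornerAlg hE'
  have h0 := Stacks.finDim_nonneg (Stacks.CornerAlg I E')
  -- The finitistic dimension of Λ' is a natural number: nonnegative because Λ' is nonzero, and
  -- finite because of the assumed strict inequality.
  obtain ⟨d, hd⟩ : ∃ d : ℕ, Stacks.finDim (Stacks.CornerAlg I E') = d := by
    generalize Stacks.finDim (Stacks.CornerAlg I E') = x at hlt h0
    induction x with
    | bot => exact absurd h0 (not_le.2 (WithBot.bot_lt_coe 0))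
    | coe x =>
      induction x with
      | top => exact absurd (hlt.trans hN) (lt_irrefl (⊤ : WithBot ℕ∞))
      | coe d => exact ⟨d, rfl⟩
  rw [hd] at hlt
  have hN' := Stacks.projectiveDimension_lt_top_iff.1 hN
  refine Stacks.projectiveDimension_congr fun n => ⟨fun hn => ?_, fun hn =>
    Stacks.PdLT.cornerPart (he := Stacks.isIdempotentElem_idem I E'') h.idem_mul hn⟩
  have key {j : ℕ} (hj : d ≤ j) := h.pdLT_of_pdLT_cornerPart hI hmon hcrit hN' (j := j)
    (hd.trans_le (by exact_mod_cast hj))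
  -- For `n ≥ d + 3` take `n - 3` as bound in `key`. For smaller `n` the assumption on e''N would
  -- already force pd N ≤ d + 2, against `hlt`.
  rcases le_or_gt (d + 3) n with hdn | hdn
  · obtain ⟨j, rfl⟩ := Nat.exists_eq_add_of_le' hdn
    exact key (j := j + d) (Nat.le_add_left _ _) hn
  · have h3 := key le_rfl (Stacks.PdLT.mono hn hdn.le)
    exact absurd ((projectiveDimension_le_iff N (d + 2)).2 h3)
      (not_le.2 (by exact_mod_cast hlt))
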